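/- Let $k\ge 2$ and let $\Gamma^k=(V,L)$ be the $k$-regular tree (Cayley tree of order $k$: the infinite tree in which every vertex has exactly $k+1$ neighbours). Fix a root $\rho\in V$, orient every edge away from $\rho$, and let $\vec L$ be the set of oriented edges. Consider the SOS model with heights in $\mathbb Z$ at inverse temperature $\beta>0$, with Hamiltonian $\sum_{\langle x,y\rangle\in L}|\omega_x-\omega_y|$, transfer operator $Q(n)=e^{-\beta|n|}$ and parameter $\tau=2\cosh\beta$. A gradient Gibbs measure (GGM) is a probability measure $\nu$ on $\mathbb Z^{\vec L}$ (with the product $\sigma$-algebra) such that $\int F\,d\nu=\int\nu(d\zeta)\int\gamma'_\Lambda(d\eta\mid\zeta)F(\eta)$ for all finite $\Lambda\subset V$ and all bounded measurable $F$. Here $\gamma'_\Lambda(\cdot\mid\zeta)$ is the image, under $\omega\mapsto\nabla\omega=(\omega_y-\omega_x)_{\langle x,y\rangle\in\vec L}$, of the finite-volume Gibbs measure of the model in $\Lambda$ whose boundary condition is any height configuration with gradient $\zeta$. A (spatially homogeneous) boundary law is a function $l:\mathbb Z\to(0,\infty)$ for which there is $c>0$ with $l(i)=c\bigl(\sum_{j\in\mathbb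 Z}Q(i-j)\,l(j)\bigr)^k$ for all $i\in\mathbb Z$, the sums being finite. A GGM $\nu$ is associated with a $q$-periodic boundary law $l$ if for every finite connected $\Lambda\subset V$, $\Lambda\neq\emptyset$, there is a constant $Z_\Lambda>0$ such that for all $w\in\Lambda$ and $\zeta\in\mathbb Z^{\vec L}$ $$\nu\bigl(\eta_b=\zeta_b\text{ for all edges }b\subset\Lambda\cup\partial\Lambda\bigr)=Z_\Lambda\Bigl(\sum_{s=0}^{q-1}\prod_{y\in\partial\Lambda}l\bigl(s+\textstyle\sum_{b\in\Gamma(w,y)}\zeta_b\bigr)\Bigr)\prod_{b\cap\Lambda\ne\emptyset}Q(\zeta_b),$$ where $\partial\Lambda$ is the outer vertex boundary and $\Gamma(w,y)$ the path from $w$ to $y$ ($\zeta_b$ is counted with a minus sign if $b$ is crossed against its orientation). For $a>0$ put $z^{(a)}_n=1$ if $n\equiv0\pmod 3$ and $z^{(a)}_n=a^k$ otherwise. Call a GGM *of type 3* if it is associated with a boundary law $z^{(a)}$ for some $a>0$, $a\neq1$ (considered with period $3$). **Theorem.** Let $\tau_0=\frac{2k+1}{k-1}$. There is a number $\tau_c=\tau_c(k)$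 with $0<\tau_c<\tau_0$ such that for every $\beta>0$, with $\tau=2\cosh\beta$: 1. if $\tau<\tau_c$, there is no GGM of type 3; 2. if $\tau=\tau_c$, there is exactly one GGM of type 3; 3. if $\tau>\tau_c$ and $\tau\ne\tau_0$, there are exactly two GGMs of type 3; if $\tau=\tau_0$, there is exactly one. Moreover, no GGM of type 3 is associated with a 4-periodic boundary law with values $1,a^k,1,b^k$ ($a,b>0$) at $n\equiv0,1,2,3\pmod 4$, respectively. -/

import Mathlib

open MeasureTheory

namespace SOS

noncomputable section

universe u

variable {V : Type u}

/-- An edge `⟨x, y⟩` of the graph, oriented away from the root `ρ`. In a tree every edge has exactly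
one such orientation. -/
structure OrientedEdge (G : SimpleGraph V) (ρ : V) where
  tail : V
  head : V
  adj : G.Adj tail head
  away : G.dist ρ head = G.dist ρ tail + 1

/-- Gradient configurations, with the product `σ`-algebra (`ℤ` carries its power set). -/
abbrev GradConf (G : SimpleGraph V) (ρ : V) : Type u := OrientedEdge G ρ → ℤ

/-- The gradient field of a height configuration. -/
def grad (G : SimpleGraph V) (ρ : V) (ω : V → ℤ) : GradConf G ρ :=
  fun b => ω b.head - ω b.tail

open Classical in
/-- The height increment prescribed by `ζ` when the edge `d` is crossed from `d.fst` to `d.snd`: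
`ζ` of the edge if it is crossed along its orientation, minus that value otherwise. -/
def increment {G : SimpleGraph V} {ρ : V} (ζ : GradConf G ρ) (d : G.Dart) : ℤ :=
  if h : G.dist ρ d.snd = G.dist ρ d.fst + 1 then ζ ⟨d.fst, d.snd, d.adj, h⟩
  else if h' : G.dist ρ d.fst = G.dist ρ d.snd + 1 then - ζ ⟨d.snd, d.fst, d.adj.symm, h'⟩
  else 0

/-- The unique path between two vertices of a tree. -/
def treePath {G : SimpleGraph V} (hG : G.IsTree) (x y : V) : G.Walk x y :=
  (hG.existsUnique_path x y).choose

/-- The height configuration with height `i` at `x` and gradient field `ζ`. -/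
def heightConf {G : SimpleGraph V} (hG : G.IsTree) {ρ : V} (x : V) (i : ℤ) (ζ : GradConf G ρ) :
    V → ℤ :=
  fun y => i + (((treePath hG x y).darts).map (increment ζ)).sum

/-- The outer boundary of a set of vertices. -/
def outerBoundary (G : SimpleGraph V) (Λ : Finset V) : Set V :=
  {y | y ∉ Λ ∧ ∃ x ∈ Λ, G.Adj x y}

/-- The edges with at least one endpoint in `Λ`. -/
def edgesMeeting (G : SimpleGraph V) (ρ : V) (Λ : Finset V) : Set (OrientedEdge G ρ) :=
  {b | b.tail ∈ Λ ∨ b.head ∈ Λ}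

/-! ### The Gibbsian and the gradient Gibbs specification -/

/-- The SOS Hamiltonian in the finite volume `Λ`. -/
def hamiltonian (G : SimpleGraph V) (ρ : V) (Λ : Finset V) (ω : V → ℤ) : ℝ :=
  ∑ᶠ b ∈ edgesMeeting G ρ Λ, |((grad G ρ ω b : ℤ) : ℝ)|

open Classical in
/-- The configuration equal to `σ` on `Λ` and to `ω` off `Λ`. -/
def glue (Λ : Finset V) (σ : Λ → ℤ) (ω : V → ℤ) : V → ℤ :=
  fun x => if h : x ∈ Λ then σ ⟨x, h⟩ else ω x

/-- The unnormalised finite-volume Gibbs measure with boundary condition `ω`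
(a-priori measure: counting measure). -/
def boltzmann (G : SimpleGraph V) (ρ : V) (β : ℝ) (Λ : Finset V) (ω : V → ℤ) :
    Measure (V → ℤ) :=
  Measure.sum fun σ : Λ → ℤ =>
    ENNReal.ofReal (Real.exp (-β * hamiltonian G ρ Λ (glue Λ σ ω))) • Measure.dirac (glue Λ σ ω)

/-- The Gibbsian specification of the SOS model at inverse temperature `β`. -/
def gibbsSpec (G : SimpleGraph V) (ρ : V) (β : ℝ) (Λ : Finset V) (ω : V → ℤ) :
    Measure (V → ℤ) :=
  (boltzmann G ρ β Λ ω Set.univ)⁻¹ • boltzmann G ρ β Λ ω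

/-- The gradient Gibbs specification. The height configuration with gradient `ζ` is pinned to
height `0` at the root; as the Hamiltonian depends on height differences only, another
normalisation gives the same measure. -/
def gradSpec {G : SimpleGraph V} (hG : G.IsTree) {ρ : V} (β : ℝ) (Λ : Finset V)
    (ζ : GradConf G ρ) : Measure (GradConf G ρ) :=
  (gibbsSpec G ρ β Λ (heightConf hG ρ 0 ζ)).map (grad G ρ)

/-- Gradient Gibbs measures: probability measures on gradient configurations that satisfy the DLR
equation in every finite volume. -/
def IsGradientGibbs {G : SimpleGraph V} (hG : G.IsTree) {ρ : V} (β : ℝ)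
    (ν : Measure (GradConf G ρ)) : Prop :=
  IsProbabilityMeasure ν ∧
    ∀ (Λ : Finset V) (F : GradConf G ρ → ℝ), Measurable F → (∃ C : ℝ, ∀ ζ, |F ζ| ≤ C) →
      ∫ ζ, F ζ ∂ν = ∫ ζ, (∫ η, F η ∂(gradSpec hG β Λ ζ)) ∂ν

/-! ### Boundary laws and their gradient Gibbs measures -/

/-- The SOS transfer operator, `Q(n) = θ ^ |n|` with `θ = exp (-β)`. -/
def transfer (β : ℝ) (n : ℤ) : ℝ := Real.exp (-β * |(n : ℝ)|)

/-- Spatially homogeneous boundary laws for the SOS model on the `k`-regular tree. -/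
def IsBoundaryLaw (k : ℕ) (β : ℝ) (l : ℤ → ℝ) : Prop :=
  (∀ i, 0 < l i) ∧ (∀ i, Summable fun j : ℤ => transfer β (i - j) * l j) ∧
    ∃ c : ℝ, 0 < c ∧ ∀ i, l i = c * (∑' j : ℤ, transfer β (i - j) * l j) ^ k

/-- The gradient configurations that agree with `ζ` on all edges inside `Λ ∪ ∂Λ`. -/
def cylinder {G : SimpleGraph V} {ρ : V} (Λ : Finset V) (ζ : GradConf G ρ) :
    Set (GradConf G ρ) :=
  {η | ∀ b : OrientedEdge G ρ, b.tail ∈ (Λ : Set V) ∪ outerBoundary G Λ →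
    b.head ∈ (Λ : Set V) ∪ outerBoundary G Λ → η b = ζ b}

/-- `ν` has the finite-volume marginals prescribed by the `q`-periodic homogeneous
boundary law `l`:
`ν(η = ζ on Λ ∪ ∂Λ) = Z_Λ (∑_{s mod q} ∏_{y ∈ ∂Λ} l(s + ∑_{b ∈ Γ(w,y)} ζ_b)) ∏_{b ∩ Λ ≠ ∅} Q(ζ_b)`
for all finite connected `Λ` and all `w ∈ Λ`. -/
def HasMarginals {G : SimpleGraph V} (hG : G.IsTree) {ρ : V} (β : ℝ) (q : ℕ) (l : ℤ → ℝ)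
    (ν : Measure (GradConf G ρ)) : Prop :=
  ∀ Λ : Finset V, (G.induce (Λ : Set V)).Connected →
    ∃ Z : ℝ, 0 < Z ∧ ∀ w ∈ Λ, ∀ ζ : GradConf G ρ,
      ν (cylinder Λ ζ) = ENNReal.ofReal
        (Z * (∑ s ∈ Finset.range q,
            ∏ᶠ y ∈ outerBoundary G Λ, l (heightConf hG w (s : ℤ) ζ y)) *
          ∏ᶠ b ∈ edgesMeeting G ρ Λ, transfer β (ζ b))

/-- `ν` is a gradient Gibbs measure and is the one associated with the homogeneous
boundary law `l` of period `q`. -/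
def IsGGMOf {G : SimpleGraph V} (hG : G.IsTree) {ρ : V} (k : ℕ) (β : ℝ) (q : ℕ) (l : ℤ → ℝ)
    (ν : Measure (GradConf G ρ)) : Prop :=
  IsBoundaryLaw k β l ∧ (∀ i, l (i + q) = l i) ∧ IsGradientGibbs hG β ν ∧
    HasMarginals hG β q l ν

/-- The sequence `u` with `u_n = 1` for `n ≡ 0 mod 3` and `u_n = a` otherwise. -/
def u3 (a : ℝ) (n : ℤ) : ℝ := if n % 3 = 0 then 1 else a

/-- The sequence `u` with values `1, a, 1, b` at `n ≡ 0, 1, 2, 3 mod 4`. -/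
def u4 (a b : ℝ) (n : ℤ) : ℝ := if n % 4 = 1 then a else if n % 4 = 3 then b else 1

/-- The gradient Gibbs measures of the nontrivial 3-periodic boundary laws `u_n ^ k`, where
`u = (1, a, a)` and `a ≠ 1`. -/
def ggm3 {G : SimpleGraph V} (hG : G.IsTree) (ρ : V) (k : ℕ) (β : ℝ) :
    Set (Measure (GradConf G ρ)) :=
  {ν | ∃ a : ℝ, 0 < a ∧ a ≠ 1 ∧ IsGGMOf hG k β 3 (fun n => u3 a n ^ k) ν}

/-- The gradient Gibbs measures of the 4-periodic boundary laws `u_n ^ k`, where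
`u = (1, a, 1, b)`. -/
def ggm4 {G : SimpleGraph V} (hG : G.IsTree) (ρ : V) (k : ℕ) (β : ℝ) :
    Set (Measure (GradConf G ρ)) :=
  {ν | ∃ a b : ℝ, 0 < a ∧ 0 < b ∧ IsGGMOf hG k β 4 (fun n => u4 a b n ^ k) ν}

end

end SOS

/-!
For `a ≠ 1` the sequence `u3 a n ^ k` is a boundary law exactly when `2 cosh β = f a`, where `f` is
a rational function on `(0, ∞)` that falls from `+∞` to its minimum `τ_c` at some `c < 1` and then
rises to `+∞`. The excluded point `a = 1` lies on the rising branch, at height `f 1 = τ₀`, which is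
where one of the two solutions is lost.

A `q`-periodic boundary law `l` determines exactly one gradient Gibbs measure. The heights along the
tree form a Markov chain whose transition probabilities from `i` to `j` are proportional to
`Q (i - j) * l j`, and its gradient law depends on the height at the root only modulo `q`; the
measure is the mixture over these `q` values. Along a growing connected volume the normalising sums
telescope by the boundary law equation, leaving the prescribed marginals, and these make the measure
quasi-invariant under changing finitely many heights, which is the DLR equation.

Conversely the marginals around the root determine the star sums
`∑ s < q, l (s + i) * l (s + j) * l s ^ (k - 1)` up to a factor. These recover `a` from the measure,
and they inherit the period of `l`, which separates the periods `3` and `4`.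
-/

open Set Filter Topology

namespace SOS

noncomputable section

/-! ### Valleys -/

/-- `f` falls strictly from `+∞` to its minimum at `c` and then rises strictly back to `+∞`, as the
argument runs through `(0, ∞)`. -/
structure IsValley (f : ℝ → ℝ) (c : ℝ) : Prop where
  pos : 0 < c
  continuousOn : ContinuousOn f (Ioi 0)
  strictAntiOn : StrictAntiOn f (Ioc 0 c)
  strictMonoOn : StrictMonoOn f (Ici c)
  tendsto_nhdsGT_zero : Tendsto f (𝓝[>] 0) atTop
  tendsto_atTop : Tendsto f atTop atTop

namespace IsValley

variable {f : ℝ → ℝ} {c : ℝ} (h : IsValley f c)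

include h

lemma lt_of_ne {a : ℝ} (ha : 0 < a) (hac : a ≠ c) : f c < f a := by
  rcases lt_or_gt_of_ne hac with hlt | hgt
  · exact h.strictAntiOn ⟨ha, hlt.le⟩ ⟨h.pos, le_rfl⟩ hlt
  · exact h.strictMonoOn self_mem_Ici hgt.le hgt

lemma le {a : ℝ} (ha : 0 < a) : f c ≤ f a := by
  rcases eq_or_ne a c with rfl | hac
  · exact le_rfl
  · exact (h.lt_of_ne ha hac).le

lemma exists_lt_eq {t : ℝ} (ht : f c < t) : ∃ a, 0 < a ∧ a < c ∧ f a = t := by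
  obtain ⟨e, hte, he0, hec⟩ := ((h.tendsto_nhdsGT_zero.eventually_ge_atTop t).and
    (Ioo_mem_nhdsGT h.pos)).exists
  obtain ⟨a, ha, rfl⟩ := intermediate_value_Icc' hec.le
    (h.continuousOn.mono fun x hx => he0.trans_le hx.1) ⟨ht.le, hte⟩
  exact ⟨a, he0.trans_le ha.1, ha.2.lt_of_ne (by rintro rfl; exact ht.false), rfl⟩

lemma exists_gt_eq {t : ℝ} (ht : f c < t) : ∃ b, c < b ∧ f b = t := by
  obtain ⟨e, hte, hce⟩ := ((h.tendsto_atTop.eventually_ge_atTop t).and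
    (eventually_ge_atTop c)).exists
  obtain ⟨b, hb, rfl⟩ := intermediate_value_Icc hce
    (h.continuousOn.mono fun x hx => h.pos.trans_le hx.1) ⟨ht.le, hte⟩
  exact ⟨b, hb.1.lt_of_ne (by rintro rfl; exact ht.false), rfl⟩

lemma fiber_eq_empty {t : ℝ} (ht : t < f c) : Ioi 0 ∩ f ⁻¹' {t} = ∅ :=
  eq_empty_of_forall_notMem fun _ ⟨ha, hat⟩ => (h.le ha).not_gt (hat ▸ ht)

lemma fiber_bottom : Ioi 0 ∩ f ⁻¹' {f c} = {c} := by
  refine Subset.antisymm (fun a ⟨ha, hat⟩ => ?_) (singleton_subset_iff.mpr ⟨h.pos, rfl⟩)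
  by_contra hac
  exact (h.lt_of_ne ha hac).ne' hat

lemma exists_fiber_eq_pair {t : ℝ} (ht : f c < t) : ∃ a b, a ≠ b ∧ Ioi 0 ∩ f ⁻¹' {t} = {a, b} := by
  obtain ⟨a, ha0, hac, hat⟩ := h.exists_lt_eq ht
  obtain ⟨b, hcb, hbt⟩ := h.exists_gt_eq ht
  refine ⟨a, b, (hac.trans hcb).ne, Subset.antisymm (fun x ⟨hx0, hxt⟩ => ?_) ?_⟩
  · rcases le_total x c with hxc | hcx
    · exact Or.inl (h.strictAntiOn.injOn ⟨hx0, hxc⟩ ⟨ha0, hac.le⟩ (Eq.trans hxt hat.symm))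
    · exact Or.inr (h.strictMonoOn.injOn hcx hcb.le (Eq.trans hxt hbt.symm))
  · exact pair_subset ⟨ha0, hat⟩ ⟨h.pos.trans hcb, hbt⟩

lemma encard_fiber_eq_two {t : ℝ} (ht : f c < t) : (Ioi 0 ∩ f ⁻¹' {t}).encard = 2 := by
  obtain ⟨a, b, hab, hfib⟩ := h.exists_fiber_eq_pair ht
  rw [hfib, encard_pair hab]

lemma encard_fiber_sdiff_self {p : ℝ} (hp : 0 < p) (hpc : p ≠ c) :
    ((Ioi 0 ∩ f ⁻¹' {f p}) \ {p}).encard = 1 := by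
  have hmem : p ∈ Ioi 0 ∩ f ⁻¹' {f p} := ⟨hp, rfl⟩
  have hcard := encard_sdiff_singleton_add_one hmem
  rw [h.encard_fiber_eq_two (h.lt_of_ne hp hpc)] at hcard
  exact (ENat.add_left_injective_of_ne_top ENat.one_ne_top) (hcard.trans one_add_one_eq_two.symm)

end IsValley

lemma fiber_sdiff_singleton_of_ne {α β : Type*} {f : α → β} {s : Set α} {t : β} {p : α}
    (ht : t ≠ f p) : (s ∩ f ⁻¹' {t}) \ {p} = s ∩ f ⁻¹' {t} :=
  sdiff_singleton_eq_self fun hp => ht hp.2.symm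

/-! ### The curve of nontrivial `3`-periodic boundary laws -/

/-- The value of `τ = 2 cosh β` at which `(1, a, a)` solves the boundary law equation, written as a
rational function of `a` without the removable singularity at `a = 1`. -/
def tauCurve (k : ℕ) (a : ℝ) : ℝ := 2 + (1 + 2 * a ^ k) / ∑ i ∈ Finset.Ico 1 k, a ^ i

/-- The derivative of `tauCurve` up to a positive factor, chosen such that every summand is strictly
increasing. -/
def tauSlope (k : ℕ) (a : ℝ) : ℝ :=
  ∑ i ∈ Finset.Ico 1 k, (2 * ((k : ℝ) - i) * a ^ i - i * (a ^ (k - i))⁻¹)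

section TauCurve

lemma tauSlope_continuousOn (k : ℕ) : ContinuousOn (tauSlope k) (Ioi 0) := by
  refine continuousOn_finsetSum _ fun i _ => ContinuousOn.sub (by fun_prop) ?_
  exact ContinuousOn.mul (by fun_prop)
    (ContinuousOn.inv₀ (by fun_prop) fun x hx => (pow_pos hx _).ne')

variable {k : ℕ} (hk : 2 ≤ k)

include hk

lemma sum_Ico_pow_pos {a : ℝ} (ha : 0 < a) : 0 < ∑ i ∈ Finset.Ico 1 k, a ^ i :=
  Finset.sum_pos (fun i _ => pow_pos ha i) (Finset.nonempty_Ico.mpr hk)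

lemma tauSlope_strictMonoOn : StrictMonoOn (tauSlope k) (Ioi 0) := by
  intro a ha b _ hab
  refine Finset.sum_lt_sum_of_nonempty (Finset.nonempty_Ico.mpr hk) fun i hi => ?_
  obtain ⟨hi1, hik⟩ := Finset.mem_Ico.mp hi
  have hki : (0 : ℝ) < (k : ℝ) - i := sub_pos.mpr (by exact_mod_cast hik)
  have hpow {n : ℕ} (hn : n ≠ 0) : a ^ n < b ^ n := pow_lt_pow_left₀ hab (le_of_lt ha) hn
  have hinv : (b ^ (k - i))⁻¹ < (a ^ (k - i))⁻¹ :=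
    inv_strictAnti₀ (pow_pos ha _) (hpow (by omega))
  have hi0 : (0 : ℝ) < i := by exact_mod_cast hi1
  exact sub_lt_sub (mul_lt_mul_of_pos_left (hpow (by omega)) (by positivity))
    (mul_lt_mul_of_pos_left hinv hi0)

lemma tauSlope_one_pos : 0 < tauSlope k 1 := by
  have hreflect : ∑ i ∈ Finset.Ico 1 k, ((k : ℝ) - i) = ∑ i ∈ Finset.Ico 1 k, (i : ℝ) := by
    have h := Finset.sum_Ico_reflect (fun i => (i : ℝ)) 1 (Nat.le_succ k)
    rw [Nat.add_sub_cancel_left, Nat.add_sub_cancel] at h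
    rw [← h]
    exact Finset.sum_congr rfl fun i hi => (Nat.cast_sub (Finset.mem_Ico.mp hi).2.le).symm
  have hsum : tauSlope k 1 = ∑ i ∈ Finset.Ico 1 k, (i : ℝ) := by
    simp only [tauSlope, one_pow, inv_one, mul_one]
    rw [Finset.sum_sub_distrib, ← Finset.mul_sum, hreflect]
    ring
  rw [hsum]
  exact Finset.sum_pos (fun i hi => by exact_mod_cast (Finset.mem_Ico.mp hi).1)
    (Finset.nonempty_Ico.mpr hk)

lemma hasDerivAt_tauCurve {a : ℝ} (ha : 0 < a) :
    HasDerivAt (tauCurve k) (a ^ (k - 1) / (∑ i ∈ Finset.Ico 1 k, a ^ i) ^ 2 * tauSlope k a) a := by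
  have hnum : HasDerivAt (fun a : ℝ => 1 + 2 * a ^ k) (2 * (k * a ^ (k - 1))) a :=
    ((hasDerivAt_pow k a).const_mul 2).const_add 1
  have hden : HasDerivAt (fun a : ℝ => ∑ i ∈ Finset.Ico 1 k, a ^ i)
      (∑ i ∈ Finset.Ico 1 k, i * a ^ (i - 1)) a :=
    HasDerivAt.fun_sum fun i _ => hasDerivAt_pow i a
  refine HasDerivAt.congr_deriv (f := tauCurve k)
    ((hnum.div hden (sum_Ico_pow_pos hk ha).ne').const_add 2) ?_
  rw [div_mul_eq_mul_div]
  congr 1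
  simp only [tauSlope, Finset.mul_sum]
  rw [← Finset.sum_sub_distrib]
  refine Finset.sum_congr rfl fun i hi => ?_
  obtain ⟨hi1, hik⟩ := Finset.mem_Ico.mp hi
  obtain ⟨j, rfl⟩ : ∃ j, i = j + 1 := ⟨i - 1, by omega⟩
  obtain ⟨m, rfl⟩ : ∃ m, k = j + 1 + (m + 1) := ⟨k - (j + 1) - 1, by omega⟩
  rw [show j + 1 + (m + 1) - 1 = j + m + 1 by omega, Nat.add_sub_cancel_left, Nat.add_sub_cancel]
  have : a ^ (m + 1) ≠ 0 := (pow_pos ha _).ne'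
  push_cast
  field_simp
  ring

lemma tauCurve_continuousOn : ContinuousOn (tauCurve k) (Ioi 0) :=
  fun _ ha => (hasDerivAt_tauCurve hk ha).continuousAt.continuousWithinAt

lemma deriv_tauCurve_factor_pos {a : ℝ} (ha : 0 < a) :
    0 < a ^ (k - 1) / (∑ i ∈ Finset.Ico 1 k, a ^ i) ^ 2 :=
  div_pos (pow_pos ha _) (pow_pos (sum_Ico_pow_pos hk ha) 2)

lemma strictAntiOn_tauCurve {s : Set ℝ} (hs : Convex ℝ s) (hs0 : s ⊆ Ioi 0)
    (hneg : ∀ a ∈ interior s, tauSlope k a < 0) : StrictAntiOn (tauCurve k) s := by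
  refine strictAntiOn_of_deriv_neg hs ((tauCurve_continuousOn hk).mono hs0) fun a ha => ?_
  have ha0 := hs0 (interior_subset ha)
  rw [(hasDerivAt_tauCurve hk ha0).deriv]
  exact mul_neg_of_pos_of_neg (deriv_tauCurve_factor_pos hk ha0) (hneg a ha)

lemma strictMonoOn_tauCurve {s : Set ℝ} (hs : Convex ℝ s) (hs0 : s ⊆ Ioi 0)
    (hpos : ∀ a ∈ interior s, 0 < tauSlope k a) : StrictMonoOn (tauCurve k) s := by
  refine strictMonoOn_of_deriv_pos hs ((tauCurve_continuousOn hk).mono hs0) fun a ha => ?_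
  have ha0 := hs0 (interior_subset ha)
  rw [(hasDerivAt_tauCurve hk ha0).deriv]
  exact mul_pos (deriv_tauCurve_factor_pos hk ha0) (hpos a ha)

lemma two_lt_tauCurve {a : ℝ} (ha : 0 < a) : 2 < tauCurve k a :=
  lt_add_of_pos_right 2 (div_pos (by positivity) (sum_Ico_pow_pos hk ha))

lemma tauCurve_one : tauCurve k 1 = (2 * (k : ℝ) + 1) / ((k : ℝ) - 1) := by
  have hk1 : (k : ℝ) - 1 ≠ 0 := (sub_pos.mpr (by exact_mod_cast hk)).ne'
  simp only [tauCurve, one_pow, Finset.sum_const, Nat.card_Ico, nsmul_eq_mul, mul_one]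
  rw [Nat.cast_sub (by omega), Nat.cast_one]
  field_simp
  ring

lemma tendsto_tauCurve_nhdsGT_zero : Tendsto (tauCurve k) (𝓝[>] 0) atTop := by
  have hnum : Tendsto (fun a : ℝ => 1 + 2 * a ^ k) (𝓝[>] 0) (𝓝 1) := by
    have h : Continuous fun a : ℝ => 1 + 2 * a ^ k := by fun_prop
    simpa [show k ≠ 0 by omega] using (h.tendsto 0).mono_left nhdsWithin_le_nhds
  have hden : Tendsto (fun a : ℝ => ∑ i ∈ Finset.Ico 1 k, a ^ i) (𝓝[>] 0) (𝓝[>] 0) := by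
    have h : Continuous fun a : ℝ => ∑ i ∈ Finset.Ico 1 k, a ^ i := by fun_prop
    have h0 : ∑ i ∈ Finset.Ico 1 k, (0 : ℝ) ^ i = 0 :=
      Finset.sum_eq_zero fun i hi => zero_pow (by have := Finset.mem_Ico.mp hi; omega)
    refine tendsto_nhdsWithin_iff.mpr ⟨?_, eventually_mem_nhdsWithin.mono fun a ha =>
      sum_Ico_pow_pos hk ha⟩
    simpa only [h0] using (h.tendsto 0).mono_left nhdsWithin_le_nhds
  exact tendsto_const_nhds.add_atTop (hnum.pos_mul_atTop one_pos hden.inv_tendsto_nhdsGT_zero)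

lemma div_le_tauCurve {a : ℝ} (ha1 : 1 ≤ a) : a / k ≤ tauCurve k a := by
  have ha : 0 < a := one_pos.trans_le ha1
  have hk0 : (0 : ℝ) < k := by exact_mod_cast (by omega : 0 < k)
  have hden : ∑ i ∈ Finset.Ico 1 k, a ^ i ≤ k * a ^ (k - 1) := by
    calc ∑ i ∈ Finset.Ico 1 k, a ^ i ≤ (Finset.Ico 1 k).card • a ^ (k - 1) :=
          Finset.sum_le_card_nsmul _ _ _ fun i hi =>
            pow_le_pow_right₀ ha1 (by have := Finset.mem_Ico.mp hi; omega)
      _ ≤ k * a ^ (k - 1) := by rw [nsmul_eq_mul, Nat.card_Ico]; gcongr; omega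
  have hquot : a / k ≤ (1 + 2 * a ^ k) / ∑ i ∈ Finset.Ico 1 k, a ^ i := by
    rw [div_le_div_iff₀ hk0 (sum_Ico_pow_pos hk ha)]
    calc a * ∑ i ∈ Finset.Ico 1 k, a ^ i ≤ a * (k * a ^ (k - 1)) := by gcongr
      _ = a ^ k * k := by rw [mul_left_comm, mul_pow_sub_one (by omega), mul_comm]
      _ ≤ (1 + 2 * a ^ k) * k := by gcongr; linarith [pow_pos ha k]
  exact hquot.trans (le_add_of_nonneg_left zero_le_two)

lemma tendsto_tauCurve_atTop : Tendsto (tauCurve k) atTop atTop :=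
  tendsto_atTop_mono' _ ((eventually_ge_atTop 1).mono fun _ => div_le_tauCurve hk)
    (tendsto_id.atTop_div_const (by exact_mod_cast (by omega : 0 < k)))

lemma exists_tauSlope_neg : ∃ a ∈ Ioo (0 : ℝ) 1, tauSlope k a < 0 := by
  by_contra! hnonneg
  have hpos : ∀ a ∈ interior (Ioc (0 : ℝ) 1), 0 < tauSlope k a := by
    rw [interior_Ioc]
    intro a ⟨ha0, ha1⟩
    exact (hnonneg (a / 2) ⟨by linarith, by linarith⟩).trans_lt
      (tauSlope_strictMonoOn hk (by simpa using ha0) ha0 (half_lt_self ha0))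
  have hmono := strictMonoOn_tauCurve hk (convex_Ioc 0 1) (fun _ ha => ha.1) hpos
  obtain ⟨a, hlt, ha0, ha1⟩ := ((tendsto_tauCurve_nhdsGT_zero hk).eventually_gt_atTop
    (tauCurve k 1)).and (Ioo_mem_nhdsGT one_pos) |>.exists
  exact hlt.not_ge (hmono.monotoneOn ⟨ha0, ha1.le⟩ ⟨one_pos, le_rfl⟩ ha1.le)

theorem exists_isValley_tauCurve : ∃ c < 1, IsValley (tauCurve k) c := by
  obtain ⟨a, ⟨ha0, ha1⟩, hneg⟩ := exists_tauSlope_neg hk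
  obtain ⟨c, ⟨hac, hc1⟩, hc⟩ : (0 : ℝ) ∈ tauSlope k '' Icc a 1 :=
    intermediate_value_Icc ha1.le ((tauSlope_continuousOn k).mono
      fun x hx => ha0.trans_le hx.1) ⟨hneg.le, (tauSlope_one_pos hk).le⟩
  have hc0 : 0 < c := ha0.trans_le hac
  have hmono := tauSlope_strictMonoOn hk
  refine ⟨c, hc1.lt_of_ne (by rintro rfl; exact (tauSlope_one_pos hk).ne' hc), hc0,
    tauCurve_continuousOn hk, ?_, ?_, tendsto_tauCurve_nhdsGT_zero hk, tendsto_tauCurve_atTop hk⟩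
  · refine strictAntiOn_tauCurve hk (convex_Ioc 0 c) (fun _ hx => hx.1) fun x hx => ?_
    rw [interior_Ioc] at hx
    exact hc ▸ hmono hx.1 hc0 hx.2
  · refine strictMonoOn_tauCurve hk (convex_Ici c) (fun _ hx => hc0.trans_le hx) fun x hx => ?_
    rw [interior_Ici] at hx
    exact hc ▸ hmono hc0 (hc0.trans hx) hx

end TauCurve

/-! ### The transfer operator -/

lemma transfer_pos (β : ℝ) (n : ℤ) : 0 < transfer β n := Real.exp_pos _

lemma transfer_even (β : ℝ) : (transfer β).Even := fun n => by simp [transfer]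

lemma transfer_natCast (β : ℝ) (n : ℕ) : transfer β n = Real.exp (-β) ^ n := by
  rw [← Real.exp_nat_mul, transfer, Int.cast_natCast, Nat.abs_cast, mul_comm]

lemma summable_transfer {β : ℝ} (hβ : 0 < β) : Summable (transfer β) := by
  have hnat : Summable fun n : ℕ => transfer β n := by
    simp only [transfer_natCast]
    exact summable_geometric_of_lt_one (Real.exp_pos _).le (by simpa using hβ)
  exact Summable.of_nat_of_neg hnat (by simpa only [transfer_even β _] using hnat)

lemma transfer_sub_one_add_transfer_add_one (β : ℝ) (n : ℤ) :
    transfer β (n - 1) + transfer β (n + 1)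
      = 2 * Real.cosh β * transfer β n - if n = 0 then 2 * Real.sinh β else 0 := by
  wlog hn : 0 ≤ n generalizing n
  · have h := this (-n) (by omega)
    rw [transfer_even, ← transfer_even β (-n - 1), ← transfer_even β (-n + 1)] at h
    simp only [neg_eq_zero, neg_add_rev, neg_sub, neg_neg, sub_neg_eq_add] at h
    rw [← h, add_comm, add_comm 1 n, neg_add_eq_sub]
  have hcosh : 2 * Real.cosh β = Real.exp β + Real.exp (-β) := by rw [Real.cosh_eq]; ring
  have hsinh : 2 * Real.sinh β = Real.exp β - Real.exp (-β) := by rw [Real.sinh_eq]; ring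
  have hexp : Real.exp β * Real.exp (-β) = 1 := by rw [← Real.exp_add]; simp
  lift n to ℕ using hn
  cases n with
  | zero =>
    have h1 : transfer β (-1) = Real.exp (-β) := by simp [transfer]
    have h1' : transfer β 1 = Real.exp (-β) := by simp [transfer]
    have h0 : transfer β 0 = 1 := by simp [transfer]
    simp only [Nat.cast_zero, zero_sub, zero_add, h0, h1, h1', if_true, hcosh, hsinh]
    ring
  | succ n =>
    rw [if_neg (by positivity), show ((n + 1 : ℕ) : ℤ) - 1 = n by push_cast; ring,
      show ((n + 1 : ℕ) : ℤ) + 1 = (n + 2 : ℕ) by push_cast; ring]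
    simp only [transfer_natCast, hcosh]
    linear_combination -Real.exp (-β) ^ n * hexp

/-! ### Convolution with a kernel -/

/-- The action `i ↦ ∑ⱼ Q(i - j) l(j)` of a translation-invariant kernel on functions, with the junk
value `0` where the series diverges. -/
def kernelSum {A : Type*} [Sub A] (Q l : A → ℝ) (i : A) : ℝ := ∑' j, Q (i - j) * l j

section KernelSum

variable {A : Type*} [AddCommGroup A] {Q l : A → ℝ}

lemma periodic_kernelSum {q : A} (hl : Function.Periodic l q) :
    Function.Periodic (kernelSum Q l) q := fun i => by
  unfold kernelSum
  rw [← (Equiv.addRight q).tsum_eq]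
  simp only [Equiv.coe_addRight, hl _, add_sub_add_right_eq_sub]

lemma even_kernelSum (hQ : Q.Even) (hl : l.Even) : (kernelSum Q l).Even := fun i => by
  unfold kernelSum
  rw [← (Equiv.neg A).tsum_eq]
  simp only [Equiv.neg_apply, hl _, neg_sub_neg, ← hQ (i - _), neg_sub]

lemma kernelSum_pos (hQ : ∀ i, 0 < Q i) (hl : ∀ i, 0 < l i) {i : A}
    (hsum : Summable fun j => Q (i - j) * l j) : 0 < kernelSum Q l i :=
  hsum.tsum_pos (fun j => (mul_pos (hQ _) (hl j)).le) i (mul_pos (hQ _) (hl i))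

lemma summable_kernel_mul_of_bounded (hQ : Summable Q) {C : ℝ} (hl : ∀ i, |l i| ≤ C) (i : A) :
    Summable fun j => Q (i - j) * l j := by
  have hshift : Summable fun j => |Q (i - j)| :=
    ((Equiv.subLeft i).summable_iff.mpr hQ).abs
  refine Summable.of_norm_bounded (hshift.mul_right C) fun j => ?_
  rw [Real.norm_eq_abs, abs_mul]
  exact mul_le_mul_of_nonneg_left (hl j) (abs_nonneg _)

end KernelSum

/-- Convolution with `transfer β` is a Green's function for the discrete Laplacian
`f ↦ f(· - 1) + f(· + 1) - 2 cosh β f`. -/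
lemma kernelSum_transfer_sub_one_add_add_one {β : ℝ} {l : ℤ → ℝ}
    (hl : ∀ i, Summable fun j => transfer β (i - j) * l j) (i : ℤ) :
    kernelSum (transfer β) l (i - 1) + kernelSum (transfer β) l (i + 1)
      = 2 * Real.cosh β * kernelSum (transfer β) l i - 2 * Real.sinh β * l i := by
  unfold kernelSum
  rw [← (hl (i - 1)).tsum_add (hl (i + 1)), ← tsum_mul_left,
    ← tsum_ite_eq i (fun _ => 2 * Real.sinh β * l i),
    ← ((hl i).mul_left _).tsum_sub (hasSum_ite_eq i _).summable]
  refine tsum_congr fun j => ?_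
  have h := transfer_sub_one_add_transfer_add_one β (i - j)
  rw [sub_add_eq_add_sub, sub_right_comm] at h
  rw [← add_mul]
  simp only [h, sub_mul, ite_mul, zero_mul, sub_eq_zero, eq_comm (a := i), mul_assoc]
  split_ifs with hij <;> simp [hij]

/-! ### Three-periodic boundary laws -/

/-- Taking `k`-th roots linearises the boundary law equation. -/
lemma isBoundaryLaw_pow_iff {k : ℕ} (hk : k ≠ 0) {β : ℝ} {u : ℤ → ℝ} (hu : ∀ i, 0 < u i)
    (hu0 : u 0 = 1) (hsum : ∀ i, Summable fun j => transfer β (i - j) * u j ^ k) :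
    IsBoundaryLaw k β (fun i => u i ^ k) ↔
      ∀ i, kernelSum (transfer β) (fun j => u j ^ k) i
        = u i * kernelSum (transfer β) (fun j => u j ^ k) 0 := by
  set S := kernelSum (transfer β) (fun j => u j ^ k)
  have hSpos (i : ℤ) : 0 < S i :=
    kernelSum_pos (transfer_pos β) (fun j => pow_pos (hu j) k) (hsum i)
  constructor
  · rintro ⟨-, -, c, -, h⟩ i
    have h0 : 1 = c * S 0 ^ k := by rw [← one_pow k, ← hu0]; exact h 0
    have hi : u i ^ k = c * S i ^ k := h i
    refine (pow_left_inj₀ (hSpos i).le (mul_pos (hu i) (hSpos 0)).le hk).mp ?_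
    rw [mul_pow, hi, mul_right_comm, ← h0, one_mul]
  · intro h
    have h0 : S 0 ^ k ≠ 0 := (pow_pos (hSpos 0) k).ne'
    refine ⟨fun i => pow_pos (hu i) k, hsum, (S 0 ^ k)⁻¹, inv_pos.mpr (pow_pos (hSpos 0) k),
      fun i => ?_⟩
    change u i ^ k = _ * S i ^ k
    rw [h i, mul_pow, mul_left_comm, inv_mul_cancel₀ h0, mul_one]

lemma u3_periodic (a : ℝ) : Function.Periodic (u3 a) 3 := fun n => by simp [u3]

lemma u3_even (a : ℝ) : (u3 a).Even := fun n => by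
  simp only [u3, show -n % 3 = 0 ↔ n % 3 = 0 by omega]

lemma u3_pos {a : ℝ} (ha : 0 < a) (n : ℤ) : 0 < u3 a n := by
  unfold u3; split_ifs <;> linarith

lemma u3_pow (a : ℝ) (k : ℕ) (n : ℤ) : u3 a n ^ k = u3 (a ^ k) n := by
  unfold u3; split_ifs <;> simp

lemma abs_u3_le {a : ℝ} (ha : 0 < a) (n : ℤ) : |u3 a n| ≤ max 1 a := by
  rw [abs_of_pos (u3_pos ha n)]
  unfold u3; split_ifs <;> simp

lemma eq_ite_of_even_of_periodic_three {α : Type*} {f : ℤ → α} (heven : f.Even)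
    (hper : Function.Periodic f 3) (i : ℤ) : f i = if i % 3 = 0 then f 0 else f 1 := by
  have hmod : f i = f (i % 3) := by
    conv_lhs => rw [← Int.emod_add_mul_ediv i 3, mul_comm]
    exact hper.int_mul _ _
  have h2 : f 2 = f 1 := by simpa [heven 1] using hper (-1)
  rw [hmod]
  rcases (by omega : i % 3 = 0 ∨ i % 3 = 1 ∨ i % 3 = 2) with h | h | h <;> simp [h, h2]

section ThreePeriodic

variable {k : ℕ} {β a : ℝ}

lemma summable_transfer_mul_u3_pow (hβ : 0 < β) (ha : 0 < a) (i : ℤ) :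
    Summable fun j => transfer β (i - j) * u3 a j ^ k := by
  simp only [u3_pow]
  exact summable_kernel_mul_of_bounded (summable_transfer hβ) (abs_u3_le (pow_pos ha k)) i

lemma kernelSum_u3_one_mul (hβ : 0 < β) (ha : 0 < a) :
    kernelSum (transfer β) (u3 a) 1 * (2 * Real.cosh β - 1 + 2 * a)
      = kernelSum (transfer β) (u3 a) 0 * (1 + 2 * Real.cosh β * a) := by
  set S := kernelSum (transfer β) (u3 a)
  have hsum (i : ℤ) : Summable fun j => transfer β (i - j) * u3 a j :=
    summable_kernel_mul_of_bounded (summable_transfer hβ) (abs_u3_le ha) i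
  have hS := eq_ite_of_even_of_periodic_three (even_kernelSum (transfer_even β) (u3_even a))
    (periodic_kernelSum (Q := transfer β) (u3_periodic a))
  have h0 : S 1 + S 1 = 2 * Real.cosh β * S 0 - 2 * Real.sinh β := by
    have h := kernelSum_transfer_sub_one_add_add_one hsum 0
    rwa [hS (0 - 1), hS (0 + 1), if_neg (by decide), if_neg (by decide), show u3 a 0 = 1 by
      simp [u3], mul_one] at h
  have h1 : S 0 + S 1 = 2 * Real.cosh β * S 1 - 2 * Real.sinh β * a := by
    have h := kernelSum_transfer_sub_one_add_add_one hsum 1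
    rwa [hS (1 + 1), sub_self, if_neg (by decide), show u3 a 1 = a by simp [u3]] at h
  linear_combination a * h0 - h1

lemma tauCurve_eq_iff (hk : 2 ≤ k) {τ : ℝ} (ha : 0 < a) (ha1 : a ≠ 1) :
    tauCurve k a = τ ↔ a * (τ - 1 + 2 * a ^ k) = 1 + τ * a ^ k := by
  have hgeom : (∑ i ∈ Finset.Ico 1 k, a ^ i) * (a - 1) = a ^ k - a := by
    simpa only [pow_one] using geom_sum_Ico_mul a (show 1 ≤ k by omega)
  rw [tauCurve, ← eq_sub_iff_add_eq', div_eq_iff (sum_Ico_pow_pos hk ha).ne',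
    ← mul_left_inj' (sub_ne_zero.mpr ha1), mul_assoc (τ - 2), hgeom]
  constructor <;> intro h <;> linarith

theorem isBoundaryLaw_u3_pow_iff (hk : 2 ≤ k) (hβ : 0 < β) (ha : 0 < a) (ha1 : a ≠ 1) :
    IsBoundaryLaw k β (fun n => u3 a n ^ k) ↔ tauCurve k a = 2 * Real.cosh β := by
  rw [isBoundaryLaw_pow_iff (by omega) (u3_pos ha) (by simp [u3])
    (summable_transfer_mul_u3_pow hβ ha), tauCurve_eq_iff hk ha ha1]
  simp only [u3_pow]
  have hak : 0 < a ^ k := pow_pos ha k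
  have hsum (i : ℤ) : Summable fun j => transfer β (i - j) * u3 (a ^ k) j :=
    summable_kernel_mul_of_bounded (summable_transfer hβ) (abs_u3_le hak) i
  set S := kernelSum (transfer β) (u3 (a ^ k))
  have hS0 : S 0 ≠ 0 := (kernelSum_pos (transfer_pos β) (u3_pos hak) (hsum 0)).ne'
  have hden : 2 * Real.cosh β - 1 + 2 * a ^ k ≠ 0 := by linarith [Real.one_lt_cosh.mpr hβ.ne']
  have hratio : (∀ i, S i = u3 a i * S 0) ↔ S 1 = a * S 0 := by
    refine ⟨fun h => by simpa [u3] using h 1, fun h i => ?_⟩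
    rw [eq_ite_of_even_of_periodic_three (f := S)
      (even_kernelSum (transfer_even β) (u3_even _)) (periodic_kernelSum (u3_periodic _)) i,
      u3, ite_mul, one_mul, ← h]
  have hcross : S 1 * (2 * Real.cosh β - 1 + 2 * a ^ k) = S 0 * (1 + 2 * Real.cosh β * a ^ k) :=
    kernelSum_u3_one_mul hβ hak
  rw [hratio, ← mul_left_inj' hden, hcross, mul_comm a (S 0), mul_assoc (S 0),
    mul_right_inj' hS0, eq_comm]

end ThreePeriodic

/-! ### Heights and gradients on a tree -/

section Heights

variable {V : Type*} {G : SimpleGraph V} (hG : G.IsTree) {ρ : V}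

lemma treePath_isPath (x y : V) : (treePath hG x y).IsPath :=
  (hG.existsUnique_path x y).choose_spec.1

lemma eq_treePath {x y : V} {p : G.Walk x y} (hp : p.IsPath) : p = treePath hG x y :=
  (hG.existsUnique_path x y).choose_spec.2 p hp

lemma treePath_self (x : V) : treePath hG x x = SimpleGraph.Walk.nil :=
  (eq_treePath hG SimpleGraph.Walk.IsPath.nil).symm

include hG in
lemma length_eq_dist_of_isPath {x y : V} {p : G.Walk x y} (hp : p.IsPath) :
    p.length = G.dist x y := by
  obtain ⟨p', hp', hlen⟩ := hG.connected.exists_path_of_dist x y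
  rw [← hlen, eq_treePath hG hp, eq_treePath hG hp']

lemma treePath_head (b : OrientedEdge G ρ) :
    treePath hG ρ b.head = (treePath hG ρ b.tail).concat b.adj := by
  classical
  have htail := treePath_isPath hG ρ b.tail
  refine (eq_treePath hG (htail.concat (fun hmem => ?_) b.adj)).symm
  have hle := (treePath hG ρ b.tail).length_takeUntil_le_length hmem
  rw [length_eq_dist_of_isPath hG (htail.takeUntil hmem), length_eq_dist_of_isPath hG htail,
    b.away] at hle
  omega

include hG in
lemma tail_eq_of_head_eq {b b' : OrientedEdge G ρ} (h : b.head = b'.head) : b.tail = b'.tail := by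
  have hpen := congrArg SimpleGraph.Walk.penultimate (treePath_head hG b)
  have hpen' := congrArg SimpleGraph.Walk.penultimate (treePath_head hG b')
  rw [SimpleGraph.Walk.penultimate_concat] at hpen hpen'
  rw [← hpen, ← hpen', h]

include hG in
lemma increment_grad (ω : V → ℤ) (d : G.Dart) :
    increment (grad G ρ ω) d = ω d.snd - ω d.fst := by
  unfold increment
  split_ifs with h h'
  · rfl
  · simp [grad]
  · exact absurd (hG.dist_eq_dist_add_one_of_adj ρ d.adj) (by tauto)

include hG in
lemma sum_increment_grad (ω : V → ℤ) {x y : V} (p : G.Walk x y) :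
    (p.darts.map (increment (grad G ρ ω))).sum = ω y - ω x := by
  induction p with
  | nil => simp
  | cons h p ih =>
    rw [SimpleGraph.Walk.darts_cons, List.map_cons, List.sum_cons, ih, increment_grad hG]
    ring

lemma heightConf_grad (ω : V → ℤ) (w : V) (i : ℤ) (y : V) :
    heightConf hG w i (grad G ρ ω) y = i + (ω y - ω w) := by
  rw [heightConf, sum_increment_grad hG]

lemma grad_heightConf (i : ℤ) (ζ : GradConf G ρ) : grad G ρ (heightConf hG ρ i ζ) = ζ := by
  ext b
  have hb : increment ζ ⟨(b.tail, b.head), b.adj⟩ = ζ b := dif_pos b.away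
  simp only [grad, heightConf, treePath_head hG b, SimpleGraph.Walk.darts_concat,
    List.concat_eq_append, List.map_append, List.map_cons, List.map_nil, List.sum_append,
    List.sum_cons, List.sum_nil, hb]
  ring

include hG in
lemma grad_surjective : Function.Surjective (grad G ρ) :=
  fun ζ => ⟨_, grad_heightConf hG 0 ζ⟩

lemma grad_const_add (m : ℤ) (ω : V → ℤ) : grad G ρ (fun y => m + ω y) = grad G ρ ω := by
  ext b; simp [grad]

/-- The unordered pair of endpoints of an oriented edge, used to speak of an edge without
knowing which of its endpoints is closer to the root. -/
def OrientedEdge.ends (b : OrientedEdge G ρ) : Sym2 V := s(b.tail, b.head)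

lemma OrientedEdge.ends_injective : Function.Injective (OrientedEdge.ends (G := G) (ρ := ρ)) := by
  rintro ⟨t, h, adj, away⟩ ⟨t', h', adj', away'⟩ heq
  rcases Sym2.eq_iff.mp heq with ⟨ht, hh⟩ | ⟨ht, hh⟩ <;> dsimp only at ht hh <;> subst ht hh
  · rfl
  · omega

lemma OrientedEdge.ends_eq_iff {b : OrientedEdge G ρ} {x y : V} :
    b.ends = s(x, y) ↔ b.tail = x ∧ b.head = y ∨ b.tail = y ∧ b.head = x := Sym2.eq_iff

include hG in
lemma exists_ends_eq (ρ : V) {x y : V} (h : G.Adj x y) :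
    ∃ b : OrientedEdge G ρ, b.ends = s(x, y) := by
  rcases hG.dist_eq_dist_add_one_of_adj ρ h with h' | h'
  · exact ⟨⟨y, x, h.symm, h'⟩, Sym2.eq_swap⟩
  · exact ⟨⟨x, y, h, h'⟩, rfl⟩

lemma grad_eq_grad_iff {b : OrientedEdge G ρ} {x y : V} (hb : b.ends = s(x, y)) (ω ω' : V → ℤ) :
    grad G ρ ω b = grad G ρ ω' b ↔ ω y - ω x = ω' y - ω' x := by
  rcases OrientedEdge.ends_eq_iff.mp hb with ⟨ht, hh⟩ | ⟨ht, hh⟩ <;> simp only [grad, ht, hh]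
  omega

lemma transfer_grad (β : ℝ) {b : OrientedEdge G ρ} {x y : V} (hb : b.ends = s(x, y)) (ω : V → ℤ) :
    transfer β (grad G ρ ω b) = transfer β (ω y - ω x) := by
  rcases OrientedEdge.ends_eq_iff.mp hb with ⟨ht, hh⟩ | ⟨ht, hh⟩ <;> simp only [grad, ht, hh]
  rw [← transfer_even, neg_sub]

include hG in
lemma root_induction {P : V → Prop} (root : P ρ)
    (step : ∀ b : OrientedEdge G ρ, P b.tail → P b.head) (x : V) : P x := by
  induction hn : G.dist ρ x generalizing x with
  | zero => rwa [← ((hG.connected ρ x).dist_eq_zero_iff).mp hn]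
  | succ n ih =>
    obtain ⟨y, hxy, hdist⟩ : ∃ y, G.Adj y x ∧ G.dist ρ y = n := by
      obtain ⟨p, hp, hlen⟩ := hG.connected.exists_path_of_dist ρ x
      have hnil : ¬ p.Nil := fun h => by
        rw [SimpleGraph.Walk.length_eq_zero_iff.mpr h] at hlen; omega
      refine ⟨p.penultimate, p.adj_penultimate hnil, ?_⟩
      rw [← length_eq_dist_of_isPath hG hp.dropLast]
      simp only [SimpleGraph.Walk.length_dropLast]
      omega
    exact step ⟨y, x, hxy, by rw [hn, hdist]⟩ (ih y hdist)

end Heights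

/-! ### Finite connected volumes -/

section Volumes

variable {V : Type*} {G : SimpleGraph V} {ρ : V} {Λ : Finset V}

lemma mem_or_mem_outerBoundary_of_adj {x y : V} (hx : x ∈ Λ) (hxy : G.Adj x y) :
    y ∈ (Λ : Set V) ∪ outerBoundary G Λ :=
  or_iff_not_imp_left.mpr fun hy => ⟨hy, x, hx, hxy⟩

lemma ends_mem_of_mem_edgesMeeting {b : OrientedEdge G ρ} (hb : b ∈ edgesMeeting G ρ Λ) :
    b.tail ∈ (Λ : Set V) ∪ outerBoundary G Λ ∧ b.head ∈ (Λ : Set V) ∪ outerBoundary G Λ := by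
  rcases hb with hb | hb
  · exact ⟨Or.inl hb, mem_or_mem_outerBoundary_of_adj hb b.adj⟩
  · exact ⟨mem_or_mem_outerBoundary_of_adj hb b.adj.symm, Or.inl hb⟩

lemma finite_outerBoundary [G.LocallyFinite] (Λ : Finset V) : (outerBoundary G Λ).Finite := by
  refine (Λ.finite_toSet.biUnion fun x _ => (G.neighborSet x).toFinite).subset ?_
  rintro y ⟨-, x, hx, hxy⟩
  exact mem_biUnion (Finset.mem_coe.mpr hx) hxy

lemma finite_edgesMeeting [G.LocallyFinite] (Λ : Finset V) : (edgesMeeting G ρ Λ).Finite := by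
  have hfin := Λ.finite_toSet.union (finite_outerBoundary (G := G) Λ)
  refine Set.Finite.of_injOn (f := fun b : OrientedEdge G ρ => (b.tail, b.head))
    (fun b hb => ends_mem_of_mem_edgesMeeting hb) (fun b _ b' _ h => ?_) (hfin.prod hfin)
  exact OrientedEdge.ends_injective (congrArg (fun e : V × V => s(e.1, e.2)) h)

lemma exists_path_of_connected (hΛ : (G.induce (Λ : Set V)).Connected) {u v : V}
    (hu : u ∈ Λ) (hv : v ∈ Λ) : ∃ p : G.Walk u v, p.IsPath ∧ ∀ z ∈ p.support, z ∈ Λ := by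
  obtain ⟨p, hp, -⟩ := hΛ.exists_path_of_dist ⟨u, hu⟩ ⟨v, hv⟩
  refine ⟨p.map (SimpleGraph.Embedding.induce _).toHom,
    SimpleGraph.Walk.IsPath.map Subtype.val_injective hp, fun z hz => ?_⟩
  obtain ⟨y, -, rfl⟩ := List.mem_map.mp (SimpleGraph.Walk.support_map _ _ ▸ hz)
  exact y.2

lemma eq_of_adj_of_notMem (hG : G.IsTree) (hΛ : (G.induce (Λ : Set V)).Connected) {x u v : V}
    (hx : x ∉ Λ) (hu : u ∈ Λ) (hv : v ∈ Λ) (hxu : G.Adj x u) (hxv : G.Adj x v) : u = v := by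
  obtain ⟨p, hp, hsub⟩ := exists_path_of_connected hΛ hu hv
  have hlen := length_eq_dist_of_isPath hG (hp.cons (h := hxu) fun h => hx (hsub x h))
  rw [SimpleGraph.Walk.length_cons, SimpleGraph.dist_eq_one_iff_adj.mpr hxv] at hlen
  exact SimpleGraph.Walk.eq_of_length_eq_zero (p := p) (by omega)

lemma not_adj_of_mem_outerBoundary (hG : G.IsTree) (hΛ : (G.induce (Λ : Set V)).Connected)
    {x y : V} (hx : x ∈ outerBoundary G Λ) (hy : y ∈ outerBoundary G Λ) : ¬ G.Adj x y := by
  intro hxy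
  obtain ⟨hx, u, hu, hux⟩ := hx
  obtain ⟨hy, v, hv, hvy⟩ := hy
  obtain ⟨p, hp, hsub⟩ := exists_path_of_connected hΛ hu hv
  have hpath : (SimpleGraph.Walk.cons hux.symm (p.concat hvy)).IsPath := by
    refine (hp.concat (fun h => hy (hsub _ h)) hvy).cons fun h => ?_
    rw [SimpleGraph.Walk.support_concat, List.mem_append, List.mem_singleton] at h
    exact h.elim (fun h => hx (hsub _ h)) hxy.ne
  have hlen := length_eq_dist_of_isPath hG hpath
  rw [SimpleGraph.Walk.length_cons, SimpleGraph.Walk.length_concat,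
    SimpleGraph.dist_eq_one_iff_adj.mpr hxy] at hlen
  omega

lemma tail_mem_of_head_mem (hG : G.IsTree) (hΛ : (G.induce (Λ : Set V)).Connected) (hρ : ρ ∈ Λ)
    {b : OrientedEdge G ρ} (hb : b.head ∈ Λ) : b.tail ∈ Λ := by
  obtain ⟨p, hp, hsub⟩ := exists_path_of_connected hΛ hρ hb
  refine hsub _ ?_
  rw [eq_treePath hG hp, treePath_head hG b, SimpleGraph.Walk.support_concat]
  exact List.mem_append_left _ (SimpleGraph.Walk.end_mem_support _)

lemma tail_mem_of_mem_edgesMeeting (hG : G.IsTree) (hΛ : (G.induce (Λ : Set V)).Connected)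
    (hρ : ρ ∈ Λ) {b : OrientedEdge G ρ} (hb : b ∈ edgesMeeting G ρ Λ) : b.tail ∈ Λ :=
  hb.elim id (tail_mem_of_head_mem hG hΛ hρ)

lemma mem_cylinder_iff (hG : G.IsTree) (hΛ : (G.induce (Λ : Set V)).Connected)
    {η ζ : GradConf G ρ} : η ∈ cylinder Λ ζ ↔ ∀ b ∈ edgesMeeting G ρ Λ, η b = ζ b := by
  refine ⟨fun h b hb => h b (ends_mem_of_mem_edgesMeeting hb).1
    (ends_mem_of_mem_edgesMeeting hb).2, ?_⟩
  rintro h b (hb | hb) (hb' | hb')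
  · exact h b (Or.inl hb)
  · exact h b (Or.inl hb)
  · exact h b (Or.inr hb')
  · exact absurd b.adj (not_adj_of_mem_outerBoundary hG hΛ hb hb')

lemma measurableSet_cylinder [G.LocallyFinite] (hG : G.IsTree)
    (hΛ : (G.induce (Λ : Set V)).Connected) (ζ : GradConf G ρ) :
    MeasurableSet (cylinder Λ ζ) := by
  have hinter : cylinder Λ ζ = ⋂ b ∈ edgesMeeting G ρ Λ, {η | η b = ζ b} := by
    ext η
    simp [mem_cylinder_iff hG hΛ]
  rw [hinter]
  exact MeasurableSet.biInter (finite_edgesMeeting Λ).countable fun b _ =>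
    measurableSet_eq_fun (measurable_pi_apply b) measurable_const

lemma connected_induce_singleton (x : V) :
    (G.induce (({x} : Finset V) : Set V)).Connected := by
  rw [Finset.coe_singleton]
  have : Nonempty ({x} : Set V) := ⟨⟨x, rfl⟩⟩
  exact ⟨SimpleGraph.Preconnected.of_subsingleton⟩

lemma connected_induce_insert [DecidableEq V] (hΛ : (G.induce (Λ : Set V)).Connected) {x : V}
    (hx : x ∈ outerBoundary G Λ) : (G.induce ((insert x Λ : Finset V) : Set V)).Connected := by
  obtain ⟨-, p, hp, hpx⟩ := hx
  rw [Finset.coe_insert, insert_eq, union_comm]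
  exact SimpleGraph.connected_induce_union hΛ.preconnected
    SimpleGraph.Preconnected.of_subsingleton (Finset.mem_coe.mpr hp) rfl hpx

lemma exists_mem_outerBoundary_of_ssubset {Λ' : Finset V} (hΛ : Λ.Nonempty)
    (hΛ' : (G.induce (Λ' : Set V)).Connected) (hsub : Λ ⊂ Λ') :
    ∃ x ∈ Λ', x ∈ outerBoundary G Λ := by
  obtain ⟨u, hu⟩ := hΛ
  obtain ⟨v, hv', hv⟩ := Finset.exists_of_ssubset hsub
  obtain ⟨p, -, hp⟩ := exists_path_of_connected hΛ' (hsub.1 hu) hv'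
  obtain ⟨d, hd, hd1, hd2⟩ := p.exists_boundary_dart (Λ : Set V) hu hv
  exact ⟨d.snd, hp _ (p.dart_snd_mem_support_of_mem_darts hd), hd2, d.fst, hd1, d.adj⟩

/-- Connected volumes can be exhausted from within by adding boundary vertices one at a time. -/
lemma connected_downward_induction [DecidableEq V] {P : Finset V → Prop} {Λ' : Finset V}
    (hΛ' : (G.induce (Λ' : Set V)).Connected) (top : P Λ')
    (step : ∀ (Λ : Finset V) x, (G.induce (Λ : Set V)).Connected → x ∈ outerBoundary G Λ →
      P (insert x Λ) → P Λ)
    (hΛ : (G.induce (Λ : Set V)).Connected) (hsub : Λ ⊆ Λ') : P Λ := by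
  induction hn : (Λ' \ Λ).card generalizing Λ with
  | zero =>
    rw [Finset.card_eq_zero, Finset.sdiff_eq_empty_iff_subset] at hn
    rwa [hsub.antisymm hn]
  | succ n ih =>
    have hss : Λ ⊂ Λ' := by
      refine hsub.ssubset_of_ne fun h => ?_
      simp [h] at hn
    obtain ⟨⟨v, hv⟩⟩ := hΛ.nonempty
    obtain ⟨x, hx', hx⟩ := exists_mem_outerBoundary_of_ssubset ⟨v, hv⟩ hΛ' hss
    refine step Λ x hΛ hx (ih (connected_induce_insert hΛ hx) (Finset.insert_subset hx' hsub) ?_)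
    rw [Finset.sdiff_insert, Finset.card_erase_of_mem (Finset.mem_sdiff.mpr ⟨hx', hx.1⟩), hn,
      Nat.add_sub_cancel]

end Volumes

/-! ### Stars -/

section Stars

variable {V : Type*} {G : SimpleGraph V} {ρ : V}

/-- The edges joining `x` to a vertex of `S`. -/
def edgesFrom (G : SimpleGraph V) (ρ x : V) (S : Finset V) : Set (OrientedEdge G ρ) :=
  {b | ∃ y ∈ S, b.ends = s(x, y)}

lemma edgesFrom_finite (x : V) (S : Finset V) : (edgesFrom G ρ x S).Finite := by
  refine Set.Finite.of_injOn (f := OrientedEdge.ends) ?_ OrientedEdge.ends_injective.injOn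
    (S.finite_toSet.image fun y => s(x, y))
  rintro b ⟨y, hy, hb⟩
  exact ⟨y, hy, hb.symm⟩

lemma finprod_edgesFrom {M : Type*} [CommMonoid M] (hG : G.IsTree) {x : V} {S : Finset V}
    (hS : ∀ y ∈ S, G.Adj x y) {f : OrientedEdge G ρ → M} {g : V → M}
    (hfg : ∀ b, ∀ y ∈ S, b.ends = s(x, y) → f b = g y) :
    ∏ᶠ b ∈ edgesFrom G ρ x S, f b = ∏ y ∈ S, g y := by
  choose e he using fun y : S => exists_ends_eq hG ρ (hS y y.2)
  have hrange : edgesFrom G ρ x S = range e := by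
    ext b
    constructor
    · rintro ⟨y, hy, hb⟩
      exact ⟨⟨y, hy⟩, OrientedEdge.ends_injective ((he ⟨y, hy⟩).trans hb.symm)⟩
    · rintro ⟨y, rfl⟩
      exact ⟨y, y.2, he y⟩
  have hinj : Function.Injective e := fun y y' h =>
    Subtype.ext (Sym2.congr_right.mp ((he y).symm.trans (h ▸ he y')))
  rw [hrange, finprod_mem_range hinj, finprod_eq_prod_of_fintype, ← Finset.prod_coe_sort S g]
  exact Finset.prod_congr rfl fun y _ => hfg _ y.1 y.2 (he y)

variable [G.LocallyFinite]

lemma outerBoundary_singleton (x : V) : outerBoundary G {x} = (G.neighborFinset x : Set V) := by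
  ext y
  simp only [outerBoundary, Finset.mem_singleton, exists_eq_left, mem_ofPred_eq, Finset.mem_coe,
    SimpleGraph.mem_neighborFinset, and_iff_right_iff_imp]
  exact fun h => h.ne'

lemma edgesMeeting_singleton (x : V) :
    edgesMeeting G ρ {x} = edgesFrom G ρ x (G.neighborFinset x) := by
  ext b
  simp only [edgesMeeting, edgesFrom, Finset.mem_singleton, mem_ofPred_eq,
    SimpleGraph.mem_neighborFinset, OrientedEdge.ends_eq_iff]
  constructor
  · rintro (rfl | rfl)
    · exact ⟨_, b.adj, Or.inl ⟨rfl, rfl⟩⟩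
    · exact ⟨_, b.adj.symm, Or.inr ⟨rfl, rfl⟩⟩
  · rintro ⟨y, -, ⟨h, -⟩ | ⟨-, h⟩⟩
    exacts [Or.inl h, Or.inr h]

variable [DecidableEq V]

/-- The neighbours of `x` other than `p`: those at which a volume containing `p` but not `x`
branches out when `x` is added to it. -/
def children (G : SimpleGraph V) [G.LocallyFinite] (p x : V) : Finset V :=
  (G.neighborFinset x).erase p

lemma mem_children {p x y : V} : y ∈ children G p x ↔ y ≠ p ∧ G.Adj x y := by
  simp [children]

lemma self_notMem_children (p x : V) : x ∉ children G p x := by simp [mem_children]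

lemma card_children {k : ℕ} (hreg : G.IsRegularOfDegree (k + 1)) {p x : V} (h : G.Adj p x) :
    (children G p x).card = k := by
  rw [children, Finset.card_erase_of_mem (by simpa using h.symm),
    SimpleGraph.card_neighborFinset_eq_degree, hreg x, Nat.add_sub_cancel]

variable {Λ : Finset V} {p x : V}

lemma edgesMeeting_insert (hp : p ∈ Λ) :
    edgesMeeting G ρ (insert x Λ) = edgesMeeting G ρ Λ ∪ edgesFrom G ρ x (children G p x) := by
  ext b
  have hadj := b.adj
  simp only [edgesMeeting, edgesFrom, mem_union, mem_ofPred_eq, Finset.mem_insert, mem_children,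
    OrientedEdge.ends_eq_iff]
  constructor
  · rintro ((rfl | h) | (rfl | h))
    · by_cases h' : b.head = p
      · exact Or.inl (Or.inr (h' ▸ hp))
      · exact Or.inr ⟨_, ⟨h', hadj⟩, Or.inl ⟨rfl, rfl⟩⟩
    · exact Or.inl (Or.inl h)
    · by_cases h' : b.tail = p
      · exact Or.inl (Or.inl (h' ▸ hp))
      · exact Or.inr ⟨_, ⟨h', hadj.symm⟩, Or.inr ⟨rfl, rfl⟩⟩
    · exact Or.inl (Or.inr h)
  · rintro ((h | h) | ⟨y, -, ⟨h, -⟩ | ⟨-, h⟩⟩) <;> simp [h]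

variable (hx : x ∉ Λ) (hp : p ∈ Λ) (hpx : G.Adj p x)

include hx hp hpx in
omit [DecidableEq V] in
lemma finprod_outerBoundary_eq_mul {M : Type*} [CommMonoid M] (f : V → M) :
    ∏ᶠ y ∈ outerBoundary G Λ, f y = f x * ∏ᶠ y ∈ outerBoundary G Λ \ {x}, f y := by
  have hmem : x ∈ outerBoundary G Λ := ⟨hx, p, hp, hpx⟩
  rw [← finprod_mem_insert _ (by simp) (finite_outerBoundary Λ).sdiff, insert_sdiff_singleton,
    insert_eq_of_mem hmem]

variable (hG : G.IsTree) (hΛ : (G.induce (Λ : Set V)).Connected)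

include hx hp hpx hG hΛ

lemma children_notMem {y : V} (hy : y ∈ children G p x) :
    y ∉ (Λ : Set V) ∪ outerBoundary G Λ := by
  rw [mem_children] at hy
  rintro (h | h)
  · exact hy.1 (eq_of_adj_of_notMem hG hΛ hx h hp hy.2 hpx.symm)
  · exact not_adj_of_mem_outerBoundary hG hΛ ⟨hx, p, hp, hpx⟩ h hy.2

lemma outerBoundary_insert :
    outerBoundary G (insert x Λ) = (outerBoundary G Λ \ {x}) ∪ (children G p x : Set V) := by
  ext y
  constructor
  · rintro ⟨hy, z, hz, hzy⟩
    rw [Finset.mem_insert, not_or] at hy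
    rcases Finset.mem_insert.mp hz with rfl | hz
    · exact Or.inr (mem_children.mpr ⟨fun h => hy.2 (h ▸ hp), hzy⟩)
    · exact Or.inl ⟨⟨hy.2, z, hz, hzy⟩, hy.1⟩
  · rintro (⟨⟨hy, z, hz, hzy⟩, hyx⟩ | hy)
    · exact ⟨Finset.mem_insert.not.mpr (not_or.mpr ⟨hyx, hy⟩), z, Finset.mem_insert_of_mem hz, hzy⟩
    · have hxy := (mem_children.mp hy).2
      have hyΛ : y ∉ Λ := fun h => children_notMem hx hp hpx hG hΛ hy (Or.inl h)
      exact ⟨Finset.mem_insert.not.mpr (not_or.mpr ⟨hxy.ne', hyΛ⟩), x,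
        Finset.mem_insert_self _ _, hxy⟩

lemma finprod_outerBoundary_insert {M : Type*} [CommMonoid M] (f : V → M) :
    ∏ᶠ y ∈ outerBoundary G (insert x Λ), f y
      = (∏ᶠ y ∈ outerBoundary G Λ \ {x}, f y) * ∏ y ∈ children G p x, f y := by
  rw [outerBoundary_insert hx hp hpx hG hΛ, finprod_mem_union ?_ (finite_outerBoundary Λ).sdiff
    (Finset.finite_toSet _), finprod_mem_coe_finset]
  exact disjoint_left.mpr fun y hy hy' => children_notMem hx hp hpx hG hΛ hy' (Or.inr hy.1)

lemma finprod_edgesMeeting_insert {M : Type*} [CommMonoid M] {f : OrientedEdge G ρ → M}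
    {g : V → M} (hfg : ∀ b, ∀ y ∈ children G p x, b.ends = s(x, y) → f b = g y) :
    ∏ᶠ b ∈ edgesMeeting G ρ (insert x Λ), f b
      = (∏ᶠ b ∈ edgesMeeting G ρ Λ, f b) * ∏ y ∈ children G p x, g y := by
  rw [edgesMeeting_insert hp, finprod_mem_union ?_ (finite_edgesMeeting Λ) (edgesFrom_finite _ _),
    finprod_edgesFrom hG (fun y hy => (mem_children.mp hy).2) hfg]
  refine disjoint_left.mpr fun b hb ⟨y, hy, hby⟩ => children_notMem hx hp hpx hG hΛ hy ?_
  rcases OrientedEdge.ends_eq_iff.mp hby with ⟨-, rfl⟩ | ⟨rfl, -⟩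
  exacts [(ends_mem_of_mem_edgesMeeting hb).2, (ends_mem_of_mem_edgesMeeting hb).1]

end Stars

/-! ### The step distribution of a boundary law -/

section StepLaw

/-- The probability that the height changes by `m` along an edge starting at height `i`: the
transition probabilities of the Markov chain that the boundary law `l` defines on heights. -/
def stepProb (β : ℝ) (l : ℤ → ℝ) (i m : ℤ) : ℝ :=
  transfer β m * l (i + m) / kernelSum (transfer β) l i

/-- The measure on `ℤ` with point masses `stepProb β l i`. -/
def stepLaw (β : ℝ) (l : ℤ → ℝ) (i : ℤ) : Measure ℤ :=
  Measure.sum fun m => ENNReal.ofReal (stepProb β l i m) • Measure.dirac m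

lemma stepLaw_singleton (β : ℝ) (l : ℤ → ℝ) (i m : ℤ) :
    stepLaw β l i {m} = ENNReal.ofReal (stepProb β l i m) := by
  rw [stepLaw, Measure.sum_apply _ (measurableSet_singleton m), tsum_eq_single m]
  · simp
  · intro m' hm'
    simp [hm']

namespace IsBoundaryLaw

variable {k : ℕ} {β : ℝ} {l : ℤ → ℝ}

lemma kernelSum_pos (hl : IsBoundaryLaw k β l) (i : ℤ) : 0 < kernelSum (transfer β) l i :=
  SOS.kernelSum_pos (transfer_pos β) hl.1 (hl.2.1 i)

lemma stepProb_nonneg (hl : IsBoundaryLaw k β l) (i m : ℤ) : 0 ≤ stepProb β l i m :=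
  div_nonneg (mul_pos (transfer_pos _ _) (hl.1 _)).le (hl.kernelSum_pos i).le

lemma hasSum_stepProb (hl : IsBoundaryLaw k β l) (i : ℤ) : HasSum (stepProb β l i) 1 := by
  have hsum : HasSum (fun j => transfer β (i - j) * l j) (kernelSum (transfer β) l i) :=
    (hl.2.1 i).hasSum
  have hdiv := ((Equiv.addLeft i).hasSum_iff.mpr hsum).div_const (kernelSum (transfer β) l i)
  rw [div_self (hl.kernelSum_pos i).ne'] at hdiv
  refine hdiv.congr_fun fun m => ?_
  simp only [Function.comp, Equiv.coe_addLeft, stepProb]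
  rw [← transfer_even, neg_eq_iff_eq_neg.mpr (by ring : m = -(i - (i + m)))]

lemma isProbabilityMeasure_stepLaw (hl : IsBoundaryLaw k β l) (i : ℤ) :
    IsProbabilityMeasure (stepLaw β l i) := by
  constructor
  rw [stepLaw, Measure.sum_apply _ MeasurableSet.univ]
  simp only [Measure.smul_apply, measure_univ, smul_eq_mul, mul_one]
  rw [← ENNReal.ofReal_tsum_of_nonneg (hl.stepProb_nonneg i) (hl.hasSum_stepProb i).summable,
    (hl.hasSum_stepProb i).tsum_eq, ENNReal.ofReal_one]

lemma prod_stepLaw_singleton (hl : IsBoundaryLaw k β l) {ι : Type*} (S : Finset ι)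
    (i m : ι → ℤ) :
    ∏ y ∈ S, stepLaw β l (i y) {m y} = ENNReal.ofReal (∏ y ∈ S, stepProb β l (i y) (m y)) := by
  simp only [stepLaw_singleton]
  exact (ENNReal.ofReal_prod_of_nonneg fun y _ => hl.stepProb_nonneg _ _).symm

lemma prod_transfer_mul (hl : IsBoundaryLaw k β l) {ι : Type*} (S : Finset ι) (i : ℤ)
    (ω : ι → ℤ) :
    (∏ y ∈ S, l (ω y)) * ∏ y ∈ S, transfer β (ω y - i)
      = kernelSum (transfer β) l i ^ S.card * ∏ y ∈ S, stepProb β l i (ω y - i) := by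
  rw [← Finset.prod_const, ← Finset.prod_mul_distrib, ← Finset.prod_mul_distrib]
  refine Finset.prod_congr rfl fun y _ => ?_
  rw [stepProb, mul_div_cancel₀ _ (hl.kernelSum_pos i).ne', add_sub_cancel, mul_comm]

end IsBoundaryLaw

lemma tsum_pi_prod_singleton {ι α : Type*} [Fintype ι] [Countable α] [MeasurableSpace α]
    [MeasurableSingletonClass α] (μ : Measure α) [IsProbabilityMeasure μ] :
    ∑' τ : ι → α, ∏ y, μ {τ y} = 1 := by
  have huniv : Measure.pi (fun _ : ι => μ) univ = 1 := measure_univ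
  rw [← iUnion_of_singleton (ι → α), measure_iUnion (fun τ τ' hne => by simpa using hne)
    measurableSet_singleton] at huniv
  simpa only [← univ_pi_singleton, Measure.pi_pi] using huniv

end StepLaw

/-! ### Marginals in a finite volume -/

lemma finprod_mem_pos {ι R : Type*} [CommSemiring R] [PartialOrder R] [IsStrictOrderedRing R]
    {s : Set ι} {f : ι → R} (h : ∀ i ∈ s, 0 < f i) : 0 < ∏ᶠ i ∈ s, f i :=
  finprod_mem_induction (0 < ·) one_pos (fun _ _ => mul_pos) h

lemma sum_range_add_of_periodic {M : Type*} [AddCommGroup M] {q : ℕ} {f : ℤ → M}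
    (hf : Function.Periodic f q) (m : ℤ) :
    ∑ s ∈ Finset.range q, f (s + m) = ∑ s ∈ Finset.range q, f s := by
  have step (m : ℤ) : ∑ s ∈ Finset.range q, f (s + (m + 1))
      = ∑ s ∈ Finset.range q, f (s + m) := by
    have hcycle := (Finset.sum_range_succ (fun s : ℕ => f (s + m)) q).symm.trans
      (Finset.sum_range_succ' (fun s : ℕ => f (s + m)) q)
    rw [add_comm (q : ℤ) m, hf, Nat.cast_zero, zero_add] at hcycle
    rw [add_right_cancel hcycle]
    refine Finset.sum_congr rfl fun s _ => congrArg f ?_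
    push_cast
    ring
  induction m using Int.induction_on with
  | zero => simp
  | succ m ih => rw [step, ih]
  | pred m ih => rw [← ih, ← step, sub_add_cancel]

section Marginals

variable {V : Type*} {G : SimpleGraph V} {ρ : V}

/-- The Boltzmann weight of a gradient configuration in the volume `Λ`. -/
def gradWeight (β : ℝ) (Λ : Finset V) (ζ : GradConf G ρ) : ℝ :=
  ∏ᶠ b ∈ edgesMeeting G ρ Λ, transfer β (ζ b)

lemma gradWeight_pos (β : ℝ) (Λ : Finset V) (ζ : GradConf G ρ) : 0 < gradWeight β Λ ζ :=
  finprod_mem_pos fun _ _ => transfer_pos _ _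

/-- The weight of a height configuration in the volume `Λ` under the boundary law `l`: its
Boltzmann weight times the boundary law at the heights on `∂Λ`. -/
def heightWeight (G : SimpleGraph V) (ρ : V) (β : ℝ) (l : ℤ → ℝ) (Λ : Finset V) (ω : V → ℤ) : ℝ :=
  (∏ᶠ y ∈ outerBoundary G Λ, l (ω y)) * gradWeight β Λ (grad G ρ ω)

lemma heightWeight_pos (β : ℝ) {l : ℤ → ℝ} (hl : ∀ i, 0 < l i) (Λ : Finset V) (ω : V → ℤ) :
    0 < heightWeight G ρ β l Λ ω :=
  mul_pos (finprod_mem_pos fun _ _ => hl _) (gradWeight_pos _ _ _)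

lemma heightWeight_congr (β : ℝ) (l : ℤ → ℝ) {Λ : Finset V} {ω ω' : V → ℤ}
    (h : ∀ y ∈ (Λ : Set V) ∪ outerBoundary G Λ, ω y = ω' y) :
    heightWeight G ρ β l Λ ω = heightWeight G ρ β l Λ ω' := by
  refine congrArg₂ (· * ·) (finprod_mem_congr rfl fun y hy => by rw [h y (Or.inr hy)])
    (finprod_mem_congr rfl fun b hb => ?_)
  have hends := ends_mem_of_mem_edgesMeeting hb
  rw [grad, grad, h _ hends.1, h _ hends.2]

/-- The sum over the possible heights modulo `q` at the boundary in the formula for the marginal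
in `Λ`, expressed through a height configuration `ω` with the given gradient. -/
def boundaryFactor (G : SimpleGraph V) (q : ℕ) (l : ℤ → ℝ) (Λ : Finset V) (ω : V → ℤ) : ℝ :=
  ∑ s ∈ Finset.range q, ∏ᶠ y ∈ outerBoundary G Λ, l (s + ω y)

lemma boundaryFactor_mul_gradWeight (β : ℝ) (q : ℕ) (l : ℤ → ℝ) (Λ : Finset V) (ω : V → ℤ) :
    boundaryFactor G q l Λ ω * gradWeight β Λ (grad G ρ ω)
      = ∑ s ∈ Finset.range q, heightWeight G ρ β l Λ fun y => s + ω y := by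
  simp only [boundaryFactor, heightWeight, grad_const_add, Finset.sum_mul]

lemma boundaryFactor_const_add {q : ℕ} {l : ℤ → ℝ} (hper : Function.Periodic l q) (Λ : Finset V)
    (m : ℤ) (ω : V → ℤ) :
    boundaryFactor G q l Λ (fun y => m + ω y) = boundaryFactor G q l Λ ω := by
  have hper' : Function.Periodic (fun i => ∏ᶠ y ∈ outerBoundary G Λ, l (i + ω y)) q := fun i => by
    simp only [add_right_comm i, hper _]
  simpa only [boundaryFactor, add_assoc] using sum_range_add_of_periodic hper' m

/-- The instance of the marginal formula of `HasMarginals` in the single volume `Λ`, with gradient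
configurations written as gradients of heights. -/
def MarginalOn (β : ℝ) (q : ℕ) (l : ℤ → ℝ) (ν : Measure (GradConf G ρ)) (Λ : Finset V) : Prop :=
  ∃ Z : ℝ, 0 < Z ∧ ∀ ω : V → ℤ, ν (cylinder Λ (grad G ρ ω))
    = ENNReal.ofReal (Z * boundaryFactor G q l Λ ω * gradWeight β Λ (grad G ρ ω))

lemma hasMarginals_iff (hG : G.IsTree) {β : ℝ} {q : ℕ} {l : ℤ → ℝ} (hper : Function.Periodic l q)
    {ν : Measure (GradConf G ρ)} :
    HasMarginals hG β q l ν ↔ ∀ Λ : Finset V, (G.induce (Λ : Set V)).Connected →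
      MarginalOn β q l ν Λ := by
  have hfactor (Λ : Finset V) (w : V) (ω : V → ℤ) : ∑ s ∈ Finset.range q,
      ∏ᶠ y ∈ outerBoundary G Λ, l (heightConf hG w (s : ℤ) (grad G ρ ω) y)
        = boundaryFactor G q l Λ ω := by
    rw [← boundaryFactor_const_add hper Λ (-ω w)]
    simp only [heightConf_grad, boundaryFactor, sub_eq_neg_add]
  refine forall₂_congr fun Λ hΛ => exists_congr fun Z => and_congr_right fun _ =>
    ⟨fun h ω => ?_, fun h w _ ζ => ?_⟩
  · obtain ⟨⟨w, hw⟩⟩ := hΛ.nonempty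
    rw [h w hw, hfactor]
    rfl
  · obtain ⟨ω, rfl⟩ := grad_surjective hG ζ
    rw [h ω, hfactor]
    rfl

end Marginals

/-! ### Consistency of the marginals -/

section Consistency

variable {V : Type*} {G : SimpleGraph V} {ρ : V}

/-- The configuration `ω` with the heights on `C` replaced by the height at `x` plus the
increments `τ`. -/
def extendAt (C : Finset V) (x : V) (ω : V → ℤ) (τ : C → ℤ) : V → ℤ :=
  glue C (fun y => ω x + τ y) ω

lemma extendAt_of_mem {C : Finset V} {y : V} (hy : y ∈ C) (x : V) (ω : V → ℤ) (τ : C → ℤ) :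
    extendAt C x ω τ y = ω x + τ ⟨y, hy⟩ := by simp [extendAt, glue, hy]

lemma extendAt_of_notMem {C : Finset V} {y : V} (hy : y ∉ C) (x : V) (ω : V → ℤ) (τ : C → ℤ) :
    extendAt C x ω τ y = ω y := by simp [extendAt, glue, hy]

lemma const_add_extendAt (m : ℤ) (C : Finset V) (x : V) (ω : V → ℤ) (τ : C → ℤ) :
    (fun y => m + extendAt C x ω τ y) = extendAt C x (fun y => m + ω y) τ := by
  ext y
  by_cases hy : y ∈ C
  · simp only [extendAt_of_mem hy, add_assoc]
  · simp only [extendAt_of_notMem hy]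

variable [G.LocallyFinite] [DecidableEq V] {k : ℕ} {Λ : Finset V} {p x : V}
  (hx : x ∉ Λ) (hp : p ∈ Λ) (hpx : G.Adj p x)
  (hG : G.IsTree) (hΛ : (G.induce (Λ : Set V)).Connected)

include hx hp hpx hG hΛ

lemma heightWeight_insert (hreg : G.IsRegularOfDegree (k + 1)) {β c : ℝ} {l : ℤ → ℝ}
    (hl : IsBoundaryLaw k β l) (hc : ∀ i, l i = c * kernelSum (transfer β) l i ^ k)
    (ω : V → ℤ) :
    c * heightWeight G ρ β l (insert x Λ) ω
      = heightWeight G ρ β l Λ ω * ∏ y ∈ children G p x, stepProb β l (ω x) (ω y - ω x) := by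
  have hstar := hl.prod_transfer_mul (children G p x) (ω x) ω
  rw [card_children hreg hpx] at hstar
  rw [heightWeight, heightWeight, gradWeight, gradWeight,
    finprod_outerBoundary_insert hx hp hpx hG hΛ,
    finprod_edgesMeeting_insert hx hp hpx hG hΛ (fun b y _ hb => transfer_grad β hb ω),
    finprod_outerBoundary_eq_mul hx hp hpx, hc (ω x)]
  linear_combination c * (∏ᶠ y ∈ outerBoundary G Λ \ {x}, l (ω y)) *
    (∏ᶠ b ∈ edgesMeeting G ρ Λ, transfer β (grad G ρ ω b)) * hstar

lemma heightWeight_insert_extendAt (hreg : G.IsRegularOfDegree (k + 1)) {β c : ℝ} {l : ℤ → ℝ}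
    (hl : IsBoundaryLaw k β l) (hc : ∀ i, l i = c * kernelSum (transfer β) l i ^ k)
    (ω : V → ℤ) (τ : children G p x → ℤ) :
    c * heightWeight G ρ β l (insert x Λ) (extendAt (children G p x) x ω τ)
      = heightWeight G ρ β l Λ ω * ∏ y, stepProb β l (ω x) (τ y) := by
  rw [heightWeight_insert hx hp hpx hG hΛ hreg hl hc, ← Finset.prod_coe_sort]
  simp only [extendAt_of_mem (Subtype.coe_prop _),
    extendAt_of_notMem (self_notMem_children p x), add_sub_cancel_left]
  rw [heightWeight_congr β l fun y hy =>
    extendAt_of_notMem (fun hy' => children_notMem hx hp hpx hG hΛ hy' hy) x ω τ]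

lemma grad_extendAt (ω : V → ℤ) (τ : children G p x → ℤ) {b : OrientedEdge G ρ}
    (hb : b ∈ edgesMeeting G ρ Λ) :
    grad G ρ (extendAt (children G p x) x ω τ) b = grad G ρ ω b := by
  have hends := ends_mem_of_mem_edgesMeeting hb
  have hnot {y : V} (hy : y ∈ (Λ : Set V) ∪ outerBoundary G Λ) : y ∉ children G p x :=
    fun hy' => children_notMem hx hp hpx hG hΛ hy' hy
  simp only [grad, extendAt_of_notMem (hnot hends.1), extendAt_of_notMem (hnot hends.2)]

lemma grad_mem_cylinder_insert_iff (ω ω' : V → ℤ) (τ : children G p x → ℤ) :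
    grad G ρ ω' ∈ cylinder (insert x Λ) (grad G ρ (extendAt (children G p x) x ω τ)) ↔
      grad G ρ ω' ∈ cylinder Λ (grad G ρ ω) ∧ τ = fun y : children G p x => ω' y - ω' x := by
  rw [mem_cylinder_iff hG (connected_induce_insert hΛ ⟨hx, p, hp, hpx⟩), edgesMeeting_insert hp,
    mem_cylinder_iff hG hΛ]
  simp only [mem_union, or_imp, forall_and]
  refine and_congr (forall₂_congr fun b hb => by
    rw [grad_extendAt hx hp hpx hG hΛ ω τ hb]) ⟨fun h => funext fun y => ?_, ?_⟩
  · obtain ⟨b, hb⟩ := exists_ends_eq hG ρ (mem_children.mp y.2).2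
    have hdiff := (grad_eq_grad_iff hb _ _).mp (h b ⟨y, y.2, hb⟩)
    rw [hdiff, extendAt_of_mem y.2, extendAt_of_notMem (self_notMem_children p x),
      add_sub_cancel_left]
  · rintro rfl b ⟨y, hy, hb⟩
    rw [grad_eq_grad_iff hb, extendAt_of_mem hy, extendAt_of_notMem (self_notMem_children p x),
      add_sub_cancel_left]

lemma cylinder_eq_iUnion (ω : V → ℤ) :
    cylinder Λ (grad G ρ ω) = ⋃ τ : children G p x → ℤ,
      cylinder (insert x Λ) (grad G ρ (extendAt (children G p x) x ω τ)) := by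
  ext η
  obtain ⟨ω', rfl⟩ := grad_surjective hG η
  simp only [mem_iUnion, grad_mem_cylinder_insert_iff hx hp hpx hG hΛ, exists_and_left,
    exists_eq, and_true]

lemma pairwise_disjoint_cylinder (ω : V → ℤ) :
    Pairwise (Function.onFun Disjoint fun τ : children G p x → ℤ =>
      cylinder (insert x Λ) (grad G ρ (extendAt (children G p x) x ω τ))) := by
  refine fun τ τ' hne => disjoint_left.mpr fun η h h' => hne ?_
  obtain ⟨ω', rfl⟩ := grad_surjective hG η
  rw [grad_mem_cylinder_insert_iff hx hp hpx hG hΛ] at h h'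
  exact h.2.trans h'.2.symm

/-- Summing out the increments at the children of `x` leaves the marginal in `Λ`, because the
transition probabilities sum to one. -/
lemma marginalOn_of_insert (hreg : G.IsRegularOfDegree (k + 1)) {β : ℝ} {q : ℕ} {l : ℤ → ℝ}
    (hl : IsBoundaryLaw k β l) {ν : Measure (GradConf G ρ)}
    (h : MarginalOn β q l ν (insert x Λ)) : MarginalOn β q l ν Λ := by
  obtain ⟨Z, hZ, h⟩ := h
  obtain ⟨hpos, -, c, hc, hlc⟩ := id hl
  have hprob := hl.isProbabilityMeasure_stepLaw
  have hweight (s : ℕ) (ω : V → ℤ) :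
      0 ≤ Z / c * heightWeight G ρ β l Λ fun y => s + ω y :=
    (mul_pos (div_pos hZ hc) (heightWeight_pos β hpos Λ _)).le
  have hrefine (ω : V → ℤ) (τ : children G p x → ℤ) :
      ν (cylinder (insert x Λ) (grad G ρ (extendAt (children G p x) x ω τ)))
        = ∑ s ∈ Finset.range q,
            ENNReal.ofReal (Z / c * heightWeight G ρ β l Λ fun y => s + ω y) *
              ∏ y, stepLaw β l (s + ω x) {τ y} := by
    simp only [hl.prod_stepLaw_singleton, ← ENNReal.ofReal_mul (hweight _ ω)]
    rw [h, ← ENNReal.ofReal_sum_of_nonneg fun s _ => mul_nonneg (hweight s ω)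
      (Finset.prod_nonneg fun y _ => hl.stepProb_nonneg _ _), mul_assoc,
      boundaryFactor_mul_gradWeight, Finset.mul_sum]
    refine congrArg _ (Finset.sum_congr rfl fun s _ => ?_)
    rw [const_add_extendAt, mul_assoc, ← heightWeight_insert_extendAt hx hp hpx hG hΛ hreg hl hlc]
    field_simp
  refine ⟨Z / c, div_pos hZ hc, fun ω => ?_⟩
  rw [cylinder_eq_iUnion hx hp hpx hG hΛ, measure_iUnion
    (pairwise_disjoint_cylinder hx hp hpx hG hΛ ω) fun τ =>
      measurableSet_cylinder hG (connected_induce_insert hΛ ⟨hx, p, hp, hpx⟩) _]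
  simp only [hrefine]
  rw [Summable.tsum_finsetSum fun _ _ => ENNReal.summable]
  simp only [ENNReal.tsum_mul_left, tsum_pi_prod_singleton, mul_one]
  rw [← ENNReal.ofReal_sum_of_nonneg fun s _ => hweight s ω, ← Finset.mul_sum, mul_assoc,
    boundaryFactor_mul_gradWeight]

end Consistency

/-! ### The height Markov chain -/

section Chain

variable {V : Type*} {G : SimpleGraph V} (hG : G.IsTree) {ρ : V} {Λ : Finset V}

/-- The final height of a path that starts at height `s` and visits the vertices of `L` in turn,
where `ξ (y, i)` is the increment on arriving at `y` from a vertex of height `i`. -/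
def runHeight (ξ : V × ℤ → ℤ) (s : ℤ) (L : List V) : ℤ :=
  L.foldl (fun i y => i + ξ (y, i)) s

/-- The height configuration driven by the increments `ξ`, with height `s` at the root. -/
def chainHeight (ρ : V) (s : ℤ) (ξ : V × ℤ → ℤ) (x : V) : ℤ :=
  runHeight ξ s (treePath hG ρ x).support.tail

lemma chainHeight_root (s : ℤ) (ξ : V × ℤ → ℤ) : chainHeight hG ρ s ξ ρ = s := by
  simp [chainHeight, treePath_self, runHeight]

lemma grad_chainHeight (s : ℤ) (ξ : V × ℤ → ℤ) (b : OrientedEdge G ρ) :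
    grad G ρ (chainHeight hG ρ s ξ) b = ξ (b.head, chainHeight hG ρ s ξ b.tail) := by
  simp [grad, chainHeight, treePath_head hG b, runHeight, SimpleGraph.Walk.support_concat,
    List.tail_append_of_ne_nil]

lemma measurable_runHeight (s : ℤ) (L : List V) :
    Measurable fun ξ : V × ℤ → ℤ => runHeight ξ s L := by
  induction L using List.reverseRecOn with
  | nil => exact measurable_const
  | append_singleton L y ih =>
    simp only [runHeight, List.foldl_append, List.foldl_cons, List.foldl_nil]
    have hstep : Measurable fun iξ : ℤ × (V × ℤ → ℤ) => iξ.1 + iξ.2 (y, iξ.1) :=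
      measurable_from_prod_countable_right fun i =>
        measurable_const.add (measurable_pi_apply (y, i))
    exact hstep.comp (ih.prodMk measurable_id)

lemma measurable_grad_chainHeight (s : ℤ) :
    Measurable fun ξ : V × ℤ → ℤ => grad G ρ (chainHeight hG ρ s ξ) :=
  measurable_pi_lambda _ fun _ => (measurable_runHeight _ _).sub (measurable_runHeight _ _)

section Rooted

variable (hΛ : (G.induce (Λ : Set V)).Connected) (hρ : ρ ∈ Λ)

include hG hΛ hρ

lemma root_induction_of_connected {P : V → Prop} (root : P ρ)
    (step : ∀ b : OrientedEdge G ρ, b.head ∈ Λ → P b.tail → P b.head) {x : V} (hx : x ∈ Λ) :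
    P x :=
  root_induction hG (P := fun x => x ∈ Λ → P x) (fun _ => root)
    (fun b ih hb => step b hb (ih (tail_mem_of_head_mem hG hΛ hρ hb))) x hx

lemma grad_chainHeight_mem_cylinder_iff (ω : V → ℤ) (ξ : V × ℤ → ℤ) :
    grad G ρ (chainHeight hG ρ (ω ρ) ξ) ∈ cylinder Λ (grad G ρ ω) ↔
      ∀ b ∈ edgesMeeting G ρ Λ, ξ (b.head, ω b.tail) = grad G ρ ω b := by
  rw [mem_cylinder_iff hG hΛ]
  suffices hheights : (∀ b ∈ edgesMeeting G ρ Λ,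
      chainHeight hG ρ (ω ρ) ξ b.tail = ω b.tail →
        grad G ρ (chainHeight hG ρ (ω ρ) ξ) b = grad G ρ ω b) →
      ∀ b ∈ edgesMeeting G ρ Λ, chainHeight hG ρ (ω ρ) ξ b.tail = ω b.tail by
    constructor
    · intro h b hb
      rw [← h b hb, grad_chainHeight, hheights (fun b hb _ => h b hb) b hb]
    · intro h b hb
      have htail := hheights (fun b hb htail => by rw [grad_chainHeight, htail, h b hb]) b hb
      rw [grad_chainHeight, htail, h b hb]
  refine fun h b hb => root_induction_of_connected hG hΛ hρ
    (P := fun x => chainHeight hG ρ (ω ρ) ξ x = ω x) (chainHeight_root hG _ _)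
    (fun b hb htail => ?_) (tail_mem_of_mem_edgesMeeting hG hΛ hρ hb)
  have hgrad := h b (Or.inr hb) htail
  rwa [grad, grad, htail, sub_left_inj] at hgrad

end Rooted

/-- The joint law of independent increments, the one at `(y, i)` distributed as `stepLaw β l i`. -/
def driveLaw (V : Type*) (β : ℝ) (l : ℤ → ℝ) : Measure (V × ℤ → ℤ) :=
  Measure.infinitePi fun yi : V × ℤ => stepLaw β l yi.2

/-- The law of the gradient of the tree-indexed Markov chain of heights started at height `s`. -/
def chainLaw (ρ : V) (β : ℝ) (l : ℤ → ℝ) (s : ℤ) : Measure (GradConf G ρ) :=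
  (driveLaw V β l).map fun ξ => grad G ρ (chainHeight hG ρ s ξ)

/-- The probability that the tree-indexed Markov chain has the increments of `ω` on the edges
meeting `Λ`. -/
def chainWeight (G : SimpleGraph V) (ρ : V) (β : ℝ) (l : ℤ → ℝ) (Λ : Finset V) (ω : V → ℤ) : ℝ :=
  ∏ᶠ b ∈ edgesMeeting G ρ Λ, stepProb β l (ω b.tail) (grad G ρ ω b)

variable {k : ℕ} {β : ℝ} {l : ℤ → ℝ} (hl : IsBoundaryLaw k β l)

include hl

lemma IsBoundaryLaw.isProbabilityMeasure_chainLaw (s : ℤ) :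
    IsProbabilityMeasure (chainLaw hG ρ β l s) := by
  have := hl.isProbabilityMeasure_stepLaw
  have : IsProbabilityMeasure (driveLaw V β l) := by unfold driveLaw; infer_instance
  exact Measure.isProbabilityMeasure_map (measurable_grad_chainHeight hG s).aemeasurable

lemma chainLaw_cylinder [G.LocallyFinite] (hΛ : (G.induce (Λ : Set V)).Connected) (hρ : ρ ∈ Λ)
    (ω : V → ℤ) :
    chainLaw hG ρ β l (ω ρ) (cylinder Λ (grad G ρ ω))
      = ENNReal.ofReal (chainWeight G ρ β l Λ ω) := by
  classical
  have := hl.isProbabilityMeasure_stepLaw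
  rw [chainLaw, Measure.map_apply (measurable_grad_chainHeight hG _)
    (measurableSet_cylinder hG hΛ _)]
  set E := (finite_edgesMeeting (G := G) (ρ := ρ) Λ).toFinset with hE
  set site : OrientedEdge G ρ → V × ℤ := fun b => (b.head, ω b.tail) with hsite
  have hsite_inj : Function.Injective site := fun b b' h => by
    have hhead : b.head = b'.head := congrArg Prod.fst h
    exact OrientedEdge.ends_injective (by
      rw [OrientedEdge.ends, OrientedEdge.ends, tail_eq_of_head_eq hG hhead, hhead])
  have hbox : (fun ξ => grad G ρ (chainHeight hG ρ (ω ρ) ξ)) ⁻¹' cylinder Λ (grad G ρ ω)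
      = Set.pi (E.image site : Finset _) fun yi => {ω yi.1 - yi.2} := by
    ext ξ
    rw [mem_preimage, grad_chainHeight_mem_cylinder_iff hG hΛ hρ]
    simp only [Set.mem_pi, Finset.coe_image, forall_mem_image, Finset.mem_coe, mem_singleton_iff,
      hE, Finite.mem_toFinset, hsite, grad]
  rw [hbox, driveLaw, Measure.infinitePi_pi _ fun _ _ => measurableSet_singleton _,
    Finset.prod_image hsite_inj.injOn, hl.prod_stepLaw_singleton, chainWeight,
    finprod_mem_eq_finite_toFinset_prod _ (finite_edgesMeeting Λ)]
  rfl

end Chain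

/-! ### Telescoping -/

section Telescoping

variable {V : Type*} {G : SimpleGraph V} (hG : G.IsTree) {ρ : V} {Λ : Finset V}

include hG in
lemma tail_eq_of_ends_eq (hΛ : (G.induce (Λ : Set V)).Connected) (hρ : ρ ∈ Λ) {x y : V}
    (hx : x ∈ Λ) (hy : y ∉ Λ) {b : OrientedEdge G ρ} (hb : b.ends = s(x, y)) :
    b.tail = x ∧ b.head = y := by
  refine (OrientedEdge.ends_eq_iff.mp hb).resolve_right fun ⟨ht, hh⟩ => hy ?_
  rw [← ht]
  exact tail_mem_of_head_mem hG hΛ hρ (hh ▸ hx)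

variable [G.LocallyFinite] {k : ℕ} (hreg : G.IsRegularOfDegree (k + 1)) {β : ℝ} {l : ℤ → ℝ}
  (hl : IsBoundaryLaw k β l)

include hG in
lemma chainWeight_insert [DecidableEq V] (hΛ : (G.induce (Λ : Set V)).Connected) (hρ : ρ ∈ Λ)
    {p x : V} (hx : x ∉ Λ) (hp : p ∈ Λ) (hpx : G.Adj p x) (β : ℝ) (l : ℤ → ℝ) (ω : V → ℤ) :
    chainWeight G ρ β l (insert x Λ) ω
      = chainWeight G ρ β l Λ ω * ∏ y ∈ children G p x, stepProb β l (ω x) (ω y - ω x) := by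
  refine finprod_edgesMeeting_insert hx hp hpx hG hΛ fun b y hy hb => ?_
  have hyΛ : y ∉ insert x Λ := Finset.mem_insert.not.mpr <| not_or.mpr
    ⟨(mem_children.mp hy).2.ne', fun h => children_notMem hx hp hpx hG hΛ hy (Or.inl h)⟩
  obtain ⟨rfl, rfl⟩ := tail_eq_of_ends_eq hG (connected_induce_insert hΛ ⟨hx, p, hp, hpx⟩)
    (Finset.mem_insert_of_mem hρ) (Finset.mem_insert_self x Λ) hyΛ hb
  rfl

include hG hreg hl

lemma kernelSum_pow_mul_chainWeight_singleton (ω : V → ℤ) :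
    kernelSum (transfer β) l (ω ρ) ^ (k + 1) * chainWeight G ρ β l {ρ} ω
      = heightWeight G ρ β l {ρ} ω := by
  have hadj : ∀ y ∈ G.neighborFinset ρ, G.Adj ρ y := fun y hy => by simpa using hy
  rw [heightWeight, gradWeight, chainWeight, outerBoundary_singleton, finprod_mem_coe_finset,
    edgesMeeting_singleton, finprod_edgesFrom hG hadj fun b y _ hb => transfer_grad β hb ω,
    hl.prod_transfer_mul, SimpleGraph.card_neighborFinset_eq_degree, hreg ρ]
  congr 1
  refine finprod_edgesFrom hG hadj fun b y hy hb => ?_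
  obtain ⟨ht, rfl⟩ := tail_eq_of_ends_eq hG (connected_induce_singleton ρ)
    (Finset.mem_singleton_self ρ) (Finset.mem_singleton_self ρ)
    (Finset.mem_singleton.not.mpr (hadj y hy).ne') hb
  simp only [grad, ht]

lemma exists_chainWeight_eq_heightWeight (hΛ : (G.induce (Λ : Set V)).Connected) (hρ : ρ ∈ Λ) :
    ∃ C : ℝ, 0 < C ∧ ∀ ω : V → ℤ,
      kernelSum (transfer β) l (ω ρ) ^ (k + 1) * chainWeight G ρ β l Λ ω
        = C * heightWeight G ρ β l Λ ω := by
  classical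
  set Telescopes : Finset V → Prop := fun Λ => ρ ∈ Λ ∧ ∃ C : ℝ, 0 < C ∧ ∀ ω : V → ℤ,
    kernelSum (transfer β) l (ω ρ) ^ (k + 1) * chainWeight G ρ β l Λ ω
      = C * heightWeight G ρ β l Λ ω
  have hroot : Telescopes {ρ} := ⟨Finset.mem_singleton_self ρ, 1, one_pos, fun ω => by
    rw [kernelSum_pow_mul_chainWeight_singleton hG hreg hl, one_mul]⟩
  have hinsert (Λ : Finset V) (x : V) (hΛ : (G.induce (Λ : Set V)).Connected)
      (hx : x ∈ outerBoundary G Λ) : Telescopes Λ → Telescopes (insert x Λ) := by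
    rintro ⟨hρ, C, hC, h⟩
    obtain ⟨hx, p, hp, hpx⟩ := hx
    obtain ⟨-, -, c, hc, hlc⟩ := id hl
    refine ⟨Finset.mem_insert_of_mem hρ, C * c, mul_pos hC hc, fun ω => ?_⟩
    rw [chainWeight_insert hG hΛ hρ hx hp hpx, ← mul_assoc, h, mul_assoc, mul_assoc,
      heightWeight_insert hx hp hpx hG hΛ hreg hl hlc]
  refine (connected_downward_induction (P := fun Λ₀ => Telescopes Λ₀ → Telescopes Λ) hΛ id
    (fun Λ₀ x hΛ₀ hx ih => ih ∘ hinsert Λ₀ x hΛ₀ hx) (connected_induce_singleton ρ)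
    (Finset.singleton_subset_iff.mpr hρ) hroot).2

end Telescoping

/-! ### The measure of a periodic boundary law -/

section Mixture

variable {V : Type*} {G : SimpleGraph V} (hG : G.IsTree) {ρ : V} {k : ℕ} {β : ℝ} {l : ℤ → ℝ}
  {q : ℕ}

/-- The weight of the height `s` at the root, which makes the product of the transition
probabilities telescope to `heightWeight`. -/
def rootWeight (k : ℕ) (β : ℝ) (l : ℤ → ℝ) (s : ℤ) : ℝ := kernelSum (transfer β) l s ^ (k + 1)

/-- The mixture of the laws `chainLaw hG ρ β l s` over the heights `s` modulo `q`, with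
probabilities proportional to `rootWeight`. -/
def mixtureLaw (hG : G.IsTree) (ρ : V) (k : ℕ) (β : ℝ) (l : ℤ → ℝ) (q : ℕ) :
    Measure (GradConf G ρ) :=
  ∑ s ∈ Finset.range q,
    ENNReal.ofReal (rootWeight k β l s / ∑ t ∈ Finset.range q, rootWeight k β l t) •
      chainLaw hG ρ β l s

variable (hl : IsBoundaryLaw k β l) (hq : q ≠ 0)

include hl

lemma IsBoundaryLaw.rootWeight_pos (s : ℤ) : 0 < rootWeight k β l s :=
  pow_pos (hl.kernelSum_pos s) _

include hq

lemma IsBoundaryLaw.sum_rootWeight_pos : 0 < ∑ s ∈ Finset.range q, rootWeight k β l s :=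
  Finset.sum_pos (fun s _ => hl.rootWeight_pos s) (Finset.nonempty_range_iff.mpr hq)

lemma IsBoundaryLaw.isProbabilityMeasure_mixtureLaw :
    IsProbabilityMeasure (mixtureLaw hG ρ k β l q) := by
  have := hl.isProbabilityMeasure_chainLaw hG (ρ := ρ)
  constructor
  simp only [mixtureLaw, Measure.finsetSum_apply, Measure.smul_apply, measure_univ, smul_eq_mul,
    mul_one]
  rw [← ENNReal.ofReal_sum_of_nonneg fun (s : ℕ) _ =>
      (div_pos (hl.rootWeight_pos s) (hl.sum_rootWeight_pos hq)).le,
    ← Finset.sum_div, div_self (hl.sum_rootWeight_pos hq).ne', ENNReal.ofReal_one]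

variable [G.LocallyFinite] (hreg : G.IsRegularOfDegree (k + 1)) (hper : Function.Periodic l q)
  {Λ : Finset V} (hΛ : (G.induce (Λ : Set V)).Connected)

include hreg hper hΛ

lemma marginalOn_mixtureLaw_of_root_mem (hρ : ρ ∈ Λ) :
    MarginalOn β q l (mixtureLaw hG ρ k β l q) Λ := by
  obtain ⟨C, hC, htelescope⟩ := exists_chainWeight_eq_heightWeight hG hreg hl hΛ hρ
  set T := ∑ s ∈ Finset.range q, rootWeight k β l s
  have hTpos : 0 < T := hl.sum_rootWeight_pos hq
  refine ⟨C / T, div_pos hC hTpos, fun ω => ?_⟩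
  -- Both sides depend on `ω` through its gradient, so the height at the root may be taken to be 0.
  wlog hω : ω ρ = 0 generalizing ω
  · have hshift := this (fun y => -ω ρ + ω y) (neg_add_cancel _)
    rwa [grad_const_add, boundaryFactor_const_add hper] at hshift
  rw [mul_assoc, boundaryFactor_mul_gradWeight, Finset.mul_sum, ENNReal.ofReal_sum_of_nonneg
    fun s _ => (mul_pos (div_pos hC hTpos) (heightWeight_pos β hl.1 Λ _)).le]
  simp only [mixtureLaw, Measure.finsetSum_apply, Measure.smul_apply, smul_eq_mul]
  refine Finset.sum_congr rfl fun s _ => ?_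
  have hchain := chainLaw_cylinder hG hl hΛ hρ fun y => s + ω y
  have hweight := htelescope fun y => s + ω y
  rw [grad_const_add] at hchain
  simp only [hω, add_zero] at hchain hweight
  rw [hchain, ← ENNReal.ofReal_mul (div_pos (hl.rootWeight_pos s) hTpos).le, div_mul_eq_mul_div,
    rootWeight, hweight, div_mul_eq_mul_div]

lemma marginalOn_mixtureLaw : MarginalOn β q l (mixtureLaw hG ρ k β l q) Λ := by
  classical
  obtain ⟨Λ', hsub, hΛ'⟩ := SimpleGraph.extend_finset_to_connected hG.connected.preconnected
    (t := insert ρ Λ) ⟨ρ, Finset.mem_insert_self ρ Λ⟩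
  refine connected_downward_induction hΛ'
    (marginalOn_mixtureLaw_of_root_mem hG hl hq hreg hper hΛ' (hsub (Finset.mem_insert_self ρ Λ)))
    ?_ hΛ ((Finset.subset_insert ρ Λ).trans hsub)
  rintro Λ₀ x hΛ₀ ⟨hx, p, hp, hpx⟩ ih
  exact marginalOn_of_insert hx hp hpx hG hΛ₀ hreg hl ih

end Mixture

/-! ### Cylinders determine the measure -/

section Uniqueness

variable {V : Type*} {G : SimpleGraph V} [G.LocallyFinite] (hG : G.IsTree) {ρ : V}

include hG

lemma map_restrict_eq_smul_of_cylinder {Λ : Finset V} (hΛ : (G.induce (Λ : Set V)).Connected)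
    {μ ν : Measure (GradConf G ρ)} {r : ENNReal}
    (h : ∀ ζ : GradConf G ρ, μ (cylinder Λ ζ) = r * ν (cylinder Λ ζ)) :
    μ.map (finite_edgesMeeting (ρ := ρ) (G := G) Λ).toFinset.restrict
      = r • ν.map (finite_edgesMeeting (ρ := ρ) (G := G) Λ).toFinset.restrict := by
  classical
  set E := (finite_edgesMeeting (ρ := ρ) (G := G) Λ).toFinset with hE
  have hfiber (a : E → ℤ) : (E.restrict : GradConf G ρ → (E → ℤ)) ⁻¹' {a}
      = cylinder Λ fun b => if hb : b ∈ E then a ⟨b, hb⟩ else 0 := by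
    ext η
    simp only [mem_preimage, mem_singleton_iff, mem_cylinder_iff hG hΛ,
      ← Finite.mem_toFinset (finite_edgesMeeting Λ), ← hE, funext_iff, Subtype.forall]
    exact forall₂_congr fun b hb => by rw [dif_pos hb, Finset.restrict]
  refine Measure.ext_of_singleton fun a => ?_
  rw [Measure.smul_apply, smul_eq_mul,
    Measure.map_apply (Finset.measurable_restrict E) (measurableSet_singleton a),
    Measure.map_apply (Finset.measurable_restrict E) (measurableSet_singleton a), hfiber, h]

lemma ext_of_cylinder (Λ₀ : Finset V) {μ ν : Measure (GradConf G ρ)} [IsFiniteMeasure ν]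
    (h : ∀ Λ : Finset V, Λ₀ ⊆ Λ → (G.induce (Λ : Set V)).Connected →
      ∀ ζ : GradConf G ρ, μ (cylinder Λ ζ) = ν (cylinder Λ ζ)) : μ = ν := by
  classical
  refine IsProjectiveLimit.unique (P := fun I : Finset (OrientedEdge G ρ) => ν.map I.restrict)
    (fun I => ?_) (fun I => rfl)
  change μ.map I.restrict = ν.map I.restrict
  obtain ⟨Λ, hsub, hΛ⟩ := SimpleGraph.extend_finset_to_connected hG.connected.preconnected
    (t := insert ρ (Λ₀ ∪ I.image OrientedEdge.tail)) ⟨ρ, Finset.mem_insert_self _ _⟩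
  have hΛ₀ : Λ₀ ⊆ Λ := (Finset.subset_union_left.trans (Finset.subset_insert _ _)).trans hsub
  set E := (finite_edgesMeeting (ρ := ρ) (G := G) Λ).toFinset with hE
  have hIE : I ⊆ E := fun b hb => by
    rw [hE, Finite.mem_toFinset]
    exact Or.inl (hsub (Finset.mem_insert_of_mem
      (Finset.mem_union_right _ (Finset.mem_image_of_mem _ hb))))
  have hmap : μ.map E.restrict = ν.map E.restrict := by
    rw [← one_smul ENNReal (ν.map E.restrict)]
    exact map_restrict_eq_smul_of_cylinder hG hΛ fun ζ => by rw [one_mul, h Λ hΛ₀ hΛ]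
  have hcomp : (I.restrict : GradConf G ρ → (I → ℤ))
      = Finset.restrict₂ (π := fun _ => ℤ) hIE ∘ E.restrict := rfl
  rw [hcomp, ← Measure.map_map (Finset.measurable_restrict₂ hIE) (Finset.measurable_restrict E),
    ← Measure.map_map (Finset.measurable_restrict₂ hIE) (Finset.measurable_restrict E), hmap]

/-- The normalising constants `Z` of the two measures agree because both have total mass one. -/
lemma eq_of_marginalOn {β : ℝ} {q : ℕ} {l : ℤ → ℝ} {μ ν : Measure (GradConf G ρ)}
    [IsProbabilityMeasure μ] [IsProbabilityMeasure ν]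
    (hμ : ∀ Λ : Finset V, (G.induce (Λ : Set V)).Connected → MarginalOn β q l μ Λ)
    (hν : ∀ Λ : Finset V, (G.induce (Λ : Set V)).Connected → MarginalOn β q l ν Λ) :
    μ = ν := by
  refine ext_of_cylinder hG ∅ fun Λ _ hΛ ζ => ?_
  obtain ⟨Z, hZ, h⟩ := hμ Λ hΛ
  obtain ⟨Z', hZ', h'⟩ := hν Λ hΛ
  have hratio (ζ : GradConf G ρ) :
      μ (cylinder Λ ζ) = ENNReal.ofReal (Z / Z') * ν (cylinder Λ ζ) := by
    obtain ⟨ω, rfl⟩ := grad_surjective hG ζ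
    rw [h, h', ← ENNReal.ofReal_mul (div_pos hZ hZ').le]
    congr 1
    field_simp
  have hmass := congrArg (fun m => m univ) (map_restrict_eq_smul_of_cylinder hG hΛ hratio)
  simp only [Measure.smul_apply, smul_eq_mul,
    Measure.map_apply (Finset.measurable_restrict _) MeasurableSet.univ, preimage_univ,
    measure_univ, mul_one] at hmass
  rw [hratio, ← hmass, one_mul]

end Uniqueness

/-! ### The DLR equation -/

section Shift

variable {V : Type*} {G : SimpleGraph V} {ρ : V}

/-- The gradient configuration obtained from `ζ` by raising the heights in `Λ` by `φ`. -/
def shiftConf (Λ : Finset V) (φ : Λ → ℤ) (ζ : GradConf G ρ) : GradConf G ρ :=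
  ζ + grad G ρ (glue Λ φ 0)

lemma shiftConf_shiftConf (Λ : Finset V) (φ ψ : Λ → ℤ) (ζ : GradConf G ρ) :
    shiftConf Λ φ (shiftConf Λ ψ ζ) = shiftConf Λ (φ + ψ) ζ := by
  ext b
  simp only [shiftConf, grad, glue, Pi.add_apply, Pi.zero_apply]
  split_ifs <;> ring

lemma shiftConf_zero (Λ : Finset V) (ζ : GradConf G ρ) : shiftConf Λ 0 ζ = ζ := by
  ext b
  simp [shiftConf, grad, glue]

lemma shiftConf_neg_shiftConf (Λ : Finset V) (φ : Λ → ℤ) (ζ : GradConf G ρ) :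
    shiftConf Λ (-φ) (shiftConf Λ φ ζ) = ζ := by
  rw [shiftConf_shiftConf, neg_add_cancel, shiftConf_zero]

lemma shiftConf_shiftConf_neg (Λ : Finset V) (φ : Λ → ℤ) (ζ : GradConf G ρ) :
    shiftConf Λ φ (shiftConf Λ (-φ) ζ) = ζ := by
  rw [shiftConf_shiftConf, add_neg_cancel, shiftConf_zero]

lemma measurable_shiftConf (Λ : Finset V) (φ : Λ → ℤ) :
    Measurable (shiftConf (G := G) (ρ := ρ) Λ φ) := measurable_id.add_const _

lemma shiftConf_grad (Λ : Finset V) (φ : Λ → ℤ) (ω : V → ℤ) :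
    shiftConf Λ φ (grad G ρ ω) = grad G ρ (ω + glue Λ φ 0) := by
  ext b
  simp only [shiftConf, grad, Pi.add_apply]
  ring

lemma shiftConf_apply_of_notMem {Λ : Finset V} {b : OrientedEdge G ρ}
    (hb : b ∉ edgesMeeting G ρ Λ) (φ : Λ → ℤ) (ζ : GradConf G ρ) : shiftConf Λ φ ζ b = ζ b := by
  have htail : b.tail ∉ Λ := fun h => hb (Or.inl h)
  have hhead : b.head ∉ Λ := fun h => hb (Or.inr h)
  simp [shiftConf, grad, glue, htail, hhead]

lemma preimage_shiftConf_cylinder (Λ B : Finset V) (φ : Λ → ℤ) (ζ : GradConf G ρ) :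
    shiftConf Λ φ ⁻¹' cylinder B (shiftConf Λ φ ζ) = cylinder B ζ := by
  ext η
  simp [cylinder, shiftConf]

lemma edgesMeeting_mono {Λ B : Finset V} (h : Λ ⊆ B) : edgesMeeting G ρ Λ ⊆ edgesMeeting G ρ B :=
  fun _ => Or.imp (@h _) (@h _)

variable {Λ B : Finset V} (hG : G.IsTree) (hB : (G.induce (B : Set V)).Connected)

include hG hB

lemma sub_eq_sub_of_grad_eqOn {ω ω' : V → ℤ}
    (h : EqOn (grad G ρ ω) (grad G ρ ω') (edgesMeeting G ρ B)) {x y : V} (hx : x ∈ B)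
    (hy : y ∈ B) : ω x - ω' x = ω y - ω' y := by
  obtain ⟨p, -, hp⟩ := exists_path_of_connected hB hx hy
  clear hx hy
  induction p with
  | nil => rfl
  | cons hadj p ih =>
    simp only [SimpleGraph.Walk.support_cons, List.forall_mem_cons] at hp
    obtain ⟨b, hb⟩ := exists_ends_eq hG ρ hadj
    have hbB : b ∈ edgesMeeting G ρ B := by
      rcases OrientedEdge.ends_eq_iff.mp hb with ⟨rfl, -⟩ | ⟨-, rfl⟩
      exacts [Or.inl hp.1, Or.inr hp.1]
    have hstep := (grad_eq_grad_iff hb ω ω').mp (h hbB)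
    have hrest := ih hp.2
    omega

/-- A common point of two of the cylinders makes `φ - ψ` constant on `B`, where it vanishes at
`v`. -/
lemma pairwise_disjoint_cylinder_shiftConf (hΛB : Λ ⊆ B) {v : V} (hvB : v ∈ B) (hvΛ : v ∉ Λ)
    (ζ : GradConf G ρ) :
    Pairwise (Function.onFun Disjoint fun φ : Λ → ℤ => cylinder B (shiftConf Λ φ ζ)) := by
  refine fun φ ψ hne => disjoint_left.mpr fun η hφ hψ => hne (funext fun x => ?_)
  obtain ⟨ω, rfl⟩ := grad_surjective hG ζ
  rw [mem_cylinder_iff hG hB, shiftConf_grad] at hφ hψ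
  have hconst := sub_eq_sub_of_grad_eqOn hG hB
    (fun b hb => (hφ b hb).symm.trans (hψ b hb)) (hΛB x.2) hvB
  simpa [glue, hvΛ, sub_eq_zero] using hconst

end Shift

section BoltzmannWeight

variable {V : Type*} {G : SimpleGraph V} {ρ : V} {β : ℝ} {Λ B : Finset V}

/-- `gradWeight` with values in the extended nonnegative numbers. -/
def egradWeight (β : ℝ) (Λ : Finset V) (ζ : GradConf G ρ) : ENNReal :=
  ENNReal.ofReal (gradWeight β Λ ζ)

lemma egradWeight_ne_zero (β : ℝ) (Λ : Finset V) (ζ : GradConf G ρ) : egradWeight β Λ ζ ≠ 0 :=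
  (ENNReal.ofReal_pos.mpr (gradWeight_pos β Λ ζ)).ne'

lemma egradWeight_ne_top (β : ℝ) (Λ : Finset V) (ζ : GradConf G ρ) : egradWeight β Λ ζ ≠ ⊤ :=
  ENNReal.ofReal_ne_top

lemma egradWeight_congr {η ζ : GradConf G ρ} (h : EqOn η ζ (edgesMeeting G ρ Λ)) :
    egradWeight β Λ η = egradWeight β Λ ζ :=
  congrArg ENNReal.ofReal (finprod_mem_congr rfl fun b hb => by rw [h hb])

/-- The density of `A ↦ ν (shiftConf Λ φ '' A)` with respect to `ν`, for the measures `ν` whose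
marginals are given by a boundary law. -/
def shiftDensity (β : ℝ) (Λ : Finset V) (φ : Λ → ℤ) (ζ : GradConf G ρ) : ENNReal :=
  egradWeight β Λ (shiftConf Λ φ ζ) / egradWeight β Λ ζ

lemma shiftDensity_congr (φ : Λ → ℤ) {η ζ : GradConf G ρ} (h : EqOn η ζ (edgesMeeting G ρ Λ)) :
    shiftDensity β Λ φ η = shiftDensity β Λ φ ζ := by
  rw [shiftDensity, shiftDensity, egradWeight_congr h, egradWeight_congr fun b hb => ?_]
  simp only [shiftConf, Pi.add_apply, h hb]

lemma shiftDensity_mul_egradWeight (φ : Λ → ℤ) (ζ : GradConf G ρ) :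
    shiftDensity β Λ φ ζ * egradWeight β Λ ζ = egradWeight β Λ (shiftConf Λ φ ζ) :=
  ENNReal.div_mul_cancel (egradWeight_ne_zero β Λ ζ) (egradWeight_ne_top β Λ ζ)

/-- The partition function in `Λ` as a function of the gradient boundary condition. -/
def partition (β : ℝ) (Λ : Finset V) (ζ : GradConf G ρ) : ENNReal :=
  ∑' φ : Λ → ℤ, egradWeight β Λ (shiftConf Λ φ ζ)

lemma partition_shiftConf (φ : Λ → ℤ) (ζ : GradConf G ρ) :
    partition β Λ (shiftConf Λ φ ζ) = partition β Λ ζ := by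
  simp only [partition, shiftConf_shiftConf]
  exact (Equiv.addRight φ).tsum_eq fun ψ => egradWeight β Λ (shiftConf Λ ψ ζ)

lemma partition_ne_zero (ζ : GradConf G ρ) : partition β Λ ζ ≠ 0 := fun h =>
  egradWeight_ne_zero β Λ _ (ENNReal.tsum_eq_zero.mp h 0)

variable [G.LocallyFinite]

lemma measurable_egradWeight (β : ℝ) (Λ : Finset V) :
    Measurable (egradWeight (G := G) (ρ := ρ) β Λ) := by
  unfold egradWeight gradWeight
  simp only [finprod_mem_eq_finite_toFinset_prod _ (finite_edgesMeeting (ρ := ρ) (G := G) Λ)]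
  refine ENNReal.measurable_ofReal.comp (Finset.measurable_fun_prod _ fun b _ => ?_)
  exact (measurable_of_countable (transfer β)).comp (measurable_pi_apply b)

lemma measurable_shiftDensity (β : ℝ) (Λ : Finset V) (φ : Λ → ℤ) :
    Measurable (shiftDensity (G := G) (ρ := ρ) β Λ φ) :=
  ((measurable_egradWeight β Λ).comp (measurable_shiftConf Λ φ)).div (measurable_egradWeight β Λ)

lemma measurable_partition (β : ℝ) (Λ : Finset V) :
    Measurable (partition (G := G) (ρ := ρ) β Λ) :=
  Measurable.tsum fun φ => (measurable_egradWeight β Λ).comp (measurable_shiftConf Λ φ)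

lemma gradWeight_shiftConf (hΛB : Λ ⊆ B) (β : ℝ) (φ : Λ → ℤ) (ζ : GradConf G ρ) :
    gradWeight β B (shiftConf Λ φ ζ) * gradWeight β Λ ζ
      = gradWeight β B ζ * gradWeight β Λ (shiftConf Λ φ ζ) := by
  have hsplit (η : GradConf G ρ) : gradWeight β B η = gradWeight β Λ η *
      ∏ᶠ b ∈ edgesMeeting G ρ B \ edgesMeeting G ρ Λ, transfer β (η b) :=
    (finprod_mem_mul_sdiff (edgesMeeting_mono hΛB) (finite_edgesMeeting B)).symm
  have houtside : ∏ᶠ b ∈ edgesMeeting G ρ B \ edgesMeeting G ρ Λ, transfer β (shiftConf Λ φ ζ b)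
      = ∏ᶠ b ∈ edgesMeeting G ρ B \ edgesMeeting G ρ Λ, transfer β (ζ b) :=
    finprod_mem_congr rfl fun b hb => by rw [shiftConf_apply_of_notMem hb.2]
  rw [hsplit, hsplit ζ, houtside]
  ring

end BoltzmannWeight

section GradSpec

variable {V : Type*} {G : SimpleGraph V} {ρ : V} {β : ℝ} {Λ : Finset V}

lemma measurable_grad : Measurable (grad G ρ) :=
  measurable_pi_lambda _ fun _ => (measurable_pi_apply _).sub (measurable_pi_apply _)

lemma grad_glue_add (φ : Λ → ℤ) (ω : V → ℤ) :
    grad G ρ (glue Λ (φ + fun x : Λ => ω x) ω) = shiftConf Λ φ (grad G ρ ω) := by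
  rw [shiftConf_grad]
  congr 1
  ext x
  by_cases hx : x ∈ Λ <;> simp [glue, hx, add_comm]

variable [G.LocallyFinite]

lemma exp_neg_mul_hamiltonian (β : ℝ) (Λ : Finset V) (ω : V → ℤ) :
    Real.exp (-β * hamiltonian G ρ Λ ω) = gradWeight β Λ (grad G ρ ω) := by
  have hfin := finite_edgesMeeting (ρ := ρ) (G := G) Λ
  rw [hamiltonian, gradWeight, finsum_mem_eq_finite_toFinset_sum _ hfin,
    finprod_mem_eq_finite_toFinset_prod _ hfin, Finset.mul_sum, Real.exp_sum]
  rfl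

lemma boltzmann_preimage_grad (ω : V → ℤ) {A : Set (GradConf G ρ)} (hA : MeasurableSet A) :
    boltzmann G ρ β Λ ω (grad G ρ ⁻¹' A)
      = ∑' φ : Λ → ℤ, egradWeight β Λ (shiftConf Λ φ (grad G ρ ω))
          * A.indicator 1 (shiftConf Λ φ (grad G ρ ω)) := by
  rw [boltzmann, Measure.sum_apply _ (measurable_grad hA),
    ← (Equiv.addRight fun x : Λ => ω x).tsum_eq]
  refine tsum_congr fun φ => ?_
  rw [Measure.smul_apply, smul_eq_mul, Measure.dirac_apply' _ (measurable_grad hA),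
    exp_neg_mul_hamiltonian, ← grad_glue_add]
  rfl

variable (hG : G.IsTree)

lemma gradSpec_apply (ζ : GradConf G ρ) {A : Set (GradConf G ρ)} (hA : MeasurableSet A) :
    gradSpec hG β Λ ζ A = (partition β Λ ζ)⁻¹ *
      ∑' φ : Λ → ℤ, egradWeight β Λ (shiftConf Λ φ ζ) * A.indicator 1 (shiftConf Λ φ ζ) := by
  rw [gradSpec, gibbsSpec, Measure.map_apply measurable_grad hA, Measure.smul_apply, smul_eq_mul,
    boltzmann_preimage_grad _ hA, ← preimage_univ (f := grad G ρ),
    boltzmann_preimage_grad _ MeasurableSet.univ, grad_heightConf]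
  simp only [indicator_univ, Pi.one_apply, mul_one, partition]

lemma measurable_gradSpec (β : ℝ) (Λ : Finset V) : Measurable (gradSpec (ρ := ρ) hG β Λ) := by
  refine Measure.measurable_of_measurable_coe _ fun A hA => ?_
  simp only [gradSpec_apply hG _ hA]
  refine (measurable_partition β Λ).inv.mul (Measurable.tsum fun φ => ?_)
  exact ((measurable_egradWeight β Λ).comp (measurable_shiftConf Λ φ)).mul
    ((measurable_one.indicator hA).comp (measurable_shiftConf Λ φ))

end GradSpec

lemma infinite_of_isRegularOfDegree {V : Type*} {G : SimpleGraph V} [G.LocallyFinite]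
    (hG : G.IsTree) {d : ℕ} (hd : 2 ≤ d) (hreg : G.IsRegularOfDegree d) : Infinite V := by
  by_contra hfin
  rw [not_infinite_iff_finite] at hfin
  obtain ⟨v⟩ := hG.connected.nonempty
  obtain ⟨w, hw⟩ := (G.degree_pos_iff_exists_adj v).mp (by rw [hreg v]; omega)
  have : Nontrivial V := ⟨v, w, hw.ne⟩
  obtain ⟨u, -, -, hu, -⟩ := hG.exists_ne_and_degree_eq_one
  rw [hreg u] at hu
  omega

section DLR

variable {V : Type*} {G : SimpleGraph V} [G.LocallyFinite] {ρ : V} {Λ B : Finset V}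
  {β : ℝ} {q : ℕ} {l : ℤ → ℝ} {ν : Measure (GradConf G ρ)}
  (hG : G.IsTree) (hpos : ∀ i, 0 < l i)

include hG hpos

lemma measure_cylinder_shiftConf (hΛB : Λ ⊆ B) (hν : MarginalOn β q l ν B) (φ : Λ → ℤ)
    (ζ : GradConf G ρ) :
    ν (cylinder B (shiftConf Λ φ ζ)) = ν (cylinder B ζ) * shiftDensity β Λ φ ζ := by
  obtain ⟨Z, hZ, hν⟩ := hν
  obtain ⟨ω, rfl⟩ := grad_surjective hG ζ
  have hboundary : boundaryFactor G q l B (ω + glue Λ φ 0) = boundaryFactor G q l B ω :=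
    Finset.sum_congr rfl fun s _ => finprod_mem_congr rfl fun y hy => by
      have hyΛ : y ∉ Λ := fun h => hy.1 (hΛB h)
      simp [glue, hyΛ]
  have hfactor : 0 ≤ Z * boundaryFactor G q l B ω := mul_nonneg hZ.le
    (Finset.sum_nonneg fun s _ => (finprod_mem_pos fun y _ => hpos _).le)
  have hweight := gradWeight_shiftConf hΛB β φ (grad G ρ ω)
  rw [shiftDensity, ← mul_div_assoc, ENNReal.eq_div_iff (egradWeight_ne_zero _ _ _)
    (egradWeight_ne_top _ _ _), shiftConf_grad, hν, hν, hboundary, egradWeight, egradWeight,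
    ← ENNReal.ofReal_mul (gradWeight_pos _ _ _).le,
    ← ENNReal.ofReal_mul (mul_nonneg hfactor (gradWeight_pos _ _ _).le)]
  rw [shiftConf_grad] at hweight
  congr 1
  linear_combination (Z * boundaryFactor G q l B ω) * hweight

omit [G.LocallyFinite] in
lemma measure_cylinder_ne_zero (hq : q ≠ 0) (hν : MarginalOn β q l ν B) (ζ : GradConf G ρ) :
    ν (cylinder B ζ) ≠ 0 := by
  obtain ⟨Z, hZ, hν⟩ := hν
  obtain ⟨ω, rfl⟩ := grad_surjective hG ζ
  have hfactor : 0 < boundaryFactor G q l B ω :=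
    Finset.sum_pos (fun s _ => finprod_mem_pos fun y _ => hpos _) (Finset.nonempty_range_iff.mpr hq)
  rw [hν]
  exact (ENNReal.ofReal_pos.mpr (mul_pos (mul_pos hZ hfactor) (gradWeight_pos _ _ _))).ne'

variable (hν : ∀ Λ : Finset V, (G.induce (Λ : Set V)).Connected → MarginalOn β q l ν Λ)
  [IsFiniteMeasure ν]

include hν

lemma map_shiftConf_withDensity (φ : Λ → ℤ) :
    (ν.withDensity (shiftDensity β Λ φ)).map (shiftConf Λ φ) = ν := by
  refine ext_of_cylinder hG Λ fun B hΛB hB ζ => ?_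
  have hcyl := measurableSet_cylinder (ρ := ρ) hG hB
  rw [← shiftConf_shiftConf_neg Λ φ ζ, Measure.map_apply (measurable_shiftConf Λ φ) (hcyl _),
    preimage_shiftConf_cylinder, withDensity_apply _ (hcyl _),
    measure_cylinder_shiftConf hG hpos hΛB (hν B hB), mul_comm, ← setLIntegral_const]
  refine setLIntegral_congr_fun (hcyl _) fun η hη => shiftDensity_congr φ fun b hb => ?_
  exact (mem_cylinder_iff hG hB).mp hη b (edgesMeeting_mono hΛB hb)

lemma lintegral_shiftConf (φ : Λ → ℤ) {f : GradConf G ρ → ENNReal} (hf : Measurable f) :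
    ∫⁻ η, shiftDensity β Λ φ η * f (shiftConf Λ φ η) ∂ν = ∫⁻ η, f η ∂ν := by
  have hshift := measurable_shiftConf (G := G) (ρ := ρ) Λ φ
  conv_rhs => rw [← map_shiftConf_withDensity hG hpos hν φ, lintegral_map hf hshift]
  exact (lintegral_withDensity_eq_lintegral_mul _ (measurable_shiftDensity β Λ φ)
    (hf.comp hshift)).symm

variable [Infinite V] (hq : q ≠ 0)

include hq

/-- For `v` outside `Λ` the cylinders of the shifted configurations are disjoint events, whose
probabilities are proportional to the summands of the partition function. -/
lemma partition_ne_top (ζ : GradConf G ρ) : partition β Λ ζ ≠ ⊤ := by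
  classical
  obtain ⟨v, hv⟩ := Infinite.exists_notMem_finset Λ
  obtain ⟨B, hsub, hB⟩ := SimpleGraph.extend_finset_to_connected hG.connected.preconnected
    (t := insert v Λ) (Finset.insert_nonempty v Λ)
  obtain ⟨hvB, hΛB⟩ := Finset.insert_subset_iff.mp hsub
  have hbound : ν (cylinder B ζ) * partition β Λ ζ ≤ ν univ * egradWeight β Λ ζ :=
    calc ν (cylinder B ζ) * partition β Λ ζ
        = (∑' φ : Λ → ℤ, ν (cylinder B (shiftConf Λ φ ζ))) * egradWeight β Λ ζ := by
          simp only [partition, ← ENNReal.tsum_mul_left, ← ENNReal.tsum_mul_right, mul_assoc,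
            measure_cylinder_shiftConf hG hpos hΛB (hν B hB), shiftDensity_mul_egradWeight]
      _ = ν (⋃ φ : Λ → ℤ, cylinder B (shiftConf Λ φ ζ)) * egradWeight β Λ ζ := by
          rw [measure_iUnion (pairwise_disjoint_cylinder_shiftConf hG hB hΛB hvB hv ζ)
            fun φ => measurableSet_cylinder hG hB _]
      _ ≤ ν univ * egradWeight β Λ ζ := by gcongr; exact subset_univ _
  intro htop
  rw [htop, ENNReal.mul_top (measure_cylinder_ne_zero hG hpos hq (hν B hB) ζ), top_le_iff] at hbound
  exact ENNReal.mul_ne_top (measure_ne_top ν univ) (egradWeight_ne_top β Λ ζ) hbound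

lemma isProbabilityMeasure_gradSpec (ζ : GradConf G ρ) :
    IsProbabilityMeasure (gradSpec hG β Λ ζ) := by
  constructor
  rw [gradSpec_apply hG ζ MeasurableSet.univ]
  simp only [indicator_univ, Pi.one_apply, mul_one]
  exact ENNReal.inv_mul_cancel (partition_ne_zero ζ) (partition_ne_top hG hpos hν hq ζ)

/-- Undoing the shift in every summand of `gradSpec` turns the sum of the Boltzmann weights into the
partition function. -/
lemma lintegral_gradSpec {A : Set (GradConf G ρ)} (hA : MeasurableSet A) :
    ∫⁻ ζ, gradSpec hG β Λ ζ A ∂ν = ν A := by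
  set f : (Λ → ℤ) → GradConf G ρ → ENNReal := fun φ η =>
    (partition β Λ η)⁻¹ * egradWeight β Λ (shiftConf Λ (-φ) η) * A.indicator 1 η with hf
  have hfm (φ : Λ → ℤ) : Measurable (f φ) :=
    ((measurable_partition β Λ).inv.mul ((measurable_egradWeight β Λ).comp
      (measurable_shiftConf Λ (-φ)))).mul (measurable_one.indicator hA)
  have hgradSpec (ζ : GradConf G ρ) : gradSpec hG β Λ ζ A
      = ∑' φ : Λ → ℤ, shiftDensity β Λ φ ζ * f φ (shiftConf Λ φ ζ) := by
    rw [gradSpec_apply hG ζ hA, ← ENNReal.tsum_mul_left]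
    refine tsum_congr fun φ => ?_
    simp only [hf, partition_shiftConf, shiftConf_neg_shiftConf]
    rw [← shiftDensity_mul_egradWeight]
    ring
  have hsum (η : GradConf G ρ) : ∑' φ : Λ → ℤ, f φ η = A.indicator 1 η := by
    have hneg : ∑' φ : Λ → ℤ, egradWeight β Λ (shiftConf Λ (-φ) η) = partition β Λ η :=
      (Equiv.neg (Λ → ℤ)).tsum_eq fun φ => egradWeight β Λ (shiftConf Λ φ η)
    rw [ENNReal.tsum_mul_right, ENNReal.tsum_mul_left, hneg,
      ENNReal.inv_mul_cancel (partition_ne_zero η) (partition_ne_top hG hpos hν hq η), one_mul]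
  calc ∫⁻ ζ, gradSpec hG β Λ ζ A ∂ν
      = ∑' φ : Λ → ℤ, ∫⁻ ζ, shiftDensity β Λ φ ζ * f φ (shiftConf Λ φ ζ) ∂ν := by
        simp only [hgradSpec]
        exact lintegral_tsum fun φ => ((measurable_shiftDensity β Λ φ).mul
          ((hfm φ).comp (measurable_shiftConf Λ φ))).aemeasurable
    _ = ∑' φ : Λ → ℤ, ∫⁻ η, f φ η ∂ν :=
        tsum_congr fun φ => lintegral_shiftConf hG hpos hν φ (hfm φ)
    _ = ∫⁻ η, A.indicator 1 η ∂ν := by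
        rw [← lintegral_tsum fun φ => (hfm φ).aemeasurable]
        simp only [hsum]
    _ = ν A := lintegral_indicator_one hA

omit [IsFiniteMeasure ν] in
theorem isGradientGibbs_of_marginalOn [IsProbabilityMeasure ν] : IsGradientGibbs hG β ν := by
  refine ⟨inferInstance, fun Λ F hF ⟨C, hC⟩ => ?_⟩
  let κ : ProbabilityTheory.Kernel (GradConf G ρ) (GradConf G ρ) :=
    ⟨gradSpec hG β Λ, measurable_gradSpec hG β Λ⟩
  have : ProbabilityTheory.IsMarkovKernel κ :=
    ⟨isProbabilityMeasure_gradSpec hG hpos hν hq⟩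
  have hinvariant : (κ.comp (ProbabilityTheory.Kernel.const Unit ν)) () = ν := by
    ext A hA
    rw [ProbabilityTheory.Kernel.comp_apply' _ _ _ hA, ProbabilityTheory.Kernel.const_apply]
    exact lintegral_gradSpec hG hpos hν hq hA
  have hint : Integrable F ν := .of_bound hF.aestronglyMeasurable C (.of_forall hC)
  rw [← hinvariant] at hint
  have hcomp := ProbabilityTheory.Kernel.integral_comp hint
  rwa [hinvariant, ProbabilityTheory.Kernel.const_apply] at hcomp

end DLR

/-! ### Recovering the boundary law from its measure -/

section Star

/-- The boundary factor of the volume `{ρ}` when the neighbours of the root have heights `i`, `j`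
at two of them and `0` at the others. -/
def starFactor (k q : ℕ) (l : ℤ → ℝ) (i j : ℤ) : ℝ :=
  ∑ s ∈ Finset.range q, l (s + i) * (l (s + j) * l s ^ (k - 1))

lemma starFactor_nonneg (k q : ℕ) {l : ℤ → ℝ} (hl : ∀ i, 0 < l i) (i j : ℤ) :
    0 ≤ starFactor k q l i j :=
  Finset.sum_nonneg fun _ _ => (mul_pos (hl _) (mul_pos (hl _) (pow_pos (hl _) _))).le

lemma periodic_starFactor (k : ℕ) {q : ℕ} {l : ℤ → ℝ} (hper : Function.Periodic l q) (j : ℤ) :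
    Function.Periodic (fun i => starFactor k q l i j) q := fun i => by
  simp only [starFactor, ← add_assoc, hper _]

lemma starFactor_u3_sub {k : ℕ} (hk : k ≠ 0) (A : ℝ) :
    starFactor k 3 (u3 A) 0 0 - starFactor k 3 (u3 A) 1 0 = (1 - A) * (1 - A ^ k) := by
  obtain ⟨m, rfl⟩ := Nat.exists_eq_succ_of_ne_zero hk
  simp only [starFactor, Finset.sum_range_succ, Finset.sum_range_zero, u3, Nat.succ_sub_one]
  norm_num
  ring

lemma starFactor_u3_second_difference {k : ℕ} (hk : k ≠ 0) (A : ℝ) :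
    starFactor k 3 (u3 A) 0 0 - 2 * starFactor k 3 (u3 A) 1 0 + starFactor k 3 (u3 A) 1 2
      = (1 - A) ^ 2 := by
  obtain ⟨m, rfl⟩ := Nat.exists_eq_succ_of_ne_zero hk
  simp only [starFactor, Finset.sum_range_succ, Finset.sum_range_zero, u3, Nat.succ_sub_one]
  norm_num
  ring

lemma strictMonoOn_geom_sum {k : ℕ} (hk : 2 ≤ k) :
    StrictMonoOn (fun x : ℝ => ∑ i ∈ Finset.range k, x ^ i) (Ici 0) := fun x hx y _ hxy =>
  Finset.sum_lt_sum (fun i _ => pow_le_pow_left₀ hx hxy.le i)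
    ⟨1, Finset.mem_range.mpr hk, by simpa only [pow_one] using hxy⟩

/-- The quotient of the two differences of star factors is the geometric sum
`(1 - A ^ k) / (1 - A)`, which is strictly increasing in `A`. -/
lemma eq_of_starFactor_u3_eq_mul {k : ℕ} (hk : 2 ≤ k) {A B r : ℝ} (hA : 0 ≤ A) (hB : 0 ≤ B)
    (hA1 : A ≠ 1)
    (h : ∀ i j, starFactor k 3 (u3 A) i j = r * starFactor k 3 (u3 B) i j) : A = B := by
  have hk0 : k ≠ 0 := by omega
  have hfirst : (1 - A) * (1 - A ^ k) = r * ((1 - B) * (1 - B ^ k)) := by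
    rw [← starFactor_u3_sub hk0, ← starFactor_u3_sub hk0, h, h]
    ring
  have hsecond : (1 - A) ^ 2 = r * (1 - B) ^ 2 := by
    rw [← starFactor_u3_second_difference hk0, ← starFactor_u3_second_difference hk0, h, h, h]
    ring
  rw [← geom_sum_mul_neg A k, ← geom_sum_mul_neg B k] at hfirst
  refine (strictMonoOn_geom_sum hk).injOn hA hB
    (mul_left_cancel₀ (pow_ne_zero 2 (sub_ne_zero.mpr hA1.symm)) ?_)
  linear_combination hfirst - (∑ i ∈ Finset.range k, B ^ i) * hsecond

lemma pow_ne_one_of_pos {a : ℝ} (ha : 0 < a) (ha1 : a ≠ 1) {n : ℕ} (hn : n ≠ 0) : a ^ n ≠ 1 :=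
  fun h => ha1 ((pow_eq_one_iff_of_nonneg ha.le hn).mp h)

end Star

/-! ### Gradient Gibbs measures of boundary laws -/

section Classification

variable {V : Type*} {G : SimpleGraph V} [G.LocallyFinite] {hG : G.IsTree} {ρ : V} {k q q' : ℕ}
  {β : ℝ} {l l' : ℤ → ℝ} {ν : Measure (GradConf G ρ)}

lemma boundaryFactor_singleton_eq_starFactor [DecidableEq V]
    (hreg : G.IsRegularOfDegree (k + 1)) {y z : V} (hy : G.Adj ρ y) (hz : G.Adj ρ z) (hyz : y ≠ z)
    (q : ℕ) (l : ℤ → ℝ) (i j : ℤ) :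
    boundaryFactor G q l {ρ} (fun x => if x = y then i else if x = z then j else 0)
      = starFactor k q l i j := by
  have hyN : y ∈ G.neighborFinset ρ := (G.mem_neighborFinset ρ y).mpr hy
  have hzN : z ∈ (G.neighborFinset ρ).erase y :=
    Finset.mem_erase.mpr ⟨hyz.symm, (G.mem_neighborFinset ρ z).mpr hz⟩
  refine Finset.sum_congr rfl fun s _ => ?_
  have hrest : ∏ x ∈ ((G.neighborFinset ρ).erase y).erase z,
      l (s + if x = y then i else if x = z then j else 0) = l s ^ (k - 1) := by
    rw [Finset.prod_congr rfl (g := fun _ => l s) fun x hx => ?_, Finset.prod_const,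
      Finset.card_erase_of_mem hzN, Finset.card_erase_of_mem hyN,
      SimpleGraph.card_neighborFinset_eq_degree, hreg ρ, Nat.add_sub_cancel]
    simp only [Finset.mem_erase] at hx
    rw [if_neg hx.2.1, if_neg hx.1, add_zero]
  rw [outerBoundary_singleton, finprod_mem_coe_finset, ← Finset.mul_prod_erase _ _ hyN,
    ← Finset.mul_prod_erase _ _ hzN, hrest]
  beta_reduce
  rw [if_pos rfl, if_neg hyz.symm, if_pos rfl]

lemma IsGGMOf.exists_starFactor_eq_mul (hk : k ≠ 0) (hreg : G.IsRegularOfDegree (k + 1))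
    (h : IsGGMOf hG k β q l ν) (h' : IsGGMOf hG k β q' l' ν) :
    ∃ r : ℝ, ∀ i j, starFactor k q l i j = r * starFactor k q' l' i j := by
  classical
  obtain ⟨y, z, hy, hz, hyz⟩ : ∃ y z, G.Adj ρ y ∧ G.Adj ρ z ∧ y ≠ z := by
    have hcard : 1 < (G.neighborFinset ρ).card := by
      rw [SimpleGraph.card_neighborFinset_eq_degree, hreg ρ]
      omega
    simpa only [SimpleGraph.mem_neighborFinset, exists_and_left, ← and_assoc]
      using Finset.one_lt_card_iff.mp hcard
  obtain ⟨hl, hper, -, hmarg⟩ := h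
  obtain ⟨hl', hper', -, hmarg'⟩ := h'
  obtain ⟨Z, hZ, h⟩ := (hasMarginals_iff hG hper).mp hmarg {ρ} (connected_induce_singleton ρ)
  obtain ⟨Z', hZ', h'⟩ := (hasMarginals_iff hG hper').mp hmarg' {ρ} (connected_induce_singleton ρ)
  refine ⟨Z' / Z, fun i j => ?_⟩
  set ω : V → ℤ := fun x => if x = y then i else if x = z then j else 0
  have hweight := gradWeight_pos β {ρ} (grad G ρ ω)
  have heq := (h ω).symm.trans (h' ω)
  rw [boundaryFactor_singleton_eq_starFactor hreg hy hz hyz,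
    boundaryFactor_singleton_eq_starFactor hreg hy hz hyz, ENNReal.ofReal_eq_ofReal_iff
      (mul_nonneg (mul_nonneg hZ.le (starFactor_nonneg k q hl.1 i j)) hweight.le)
      (mul_nonneg (mul_nonneg hZ'.le (starFactor_nonneg k q' hl'.1 i j)) hweight.le)] at heq
  rw [div_mul_eq_mul_div, eq_div_iff hZ.ne', mul_comm]
  exact mul_right_cancel₀ hweight.ne' heq

lemma isGGMOf_iff_eq_mixtureLaw (hk : k ≠ 0) (hreg : G.IsRegularOfDegree (k + 1)) (hq : q ≠ 0)
    (hl : IsBoundaryLaw k β l) (hper : Function.Periodic l q) :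
    IsGGMOf hG k β q l ν ↔ ν = mixtureLaw hG ρ k β l q := by
  have hprob := hl.isProbabilityMeasure_mixtureLaw (ρ := ρ) hG hq
  have hmarg : ∀ Λ : Finset V, (G.induce (Λ : Set V)).Connected →
      MarginalOn β q l (mixtureLaw hG ρ k β l q) Λ :=
    fun _ hΛ => marginalOn_mixtureLaw hG hl hq hreg hper hΛ
  constructor
  · rintro ⟨-, -, ⟨hν, -⟩, h⟩
    exact eq_of_marginalOn hG ((hasMarginals_iff hG hper).mp h) hmarg
  · rintro rfl
    have := infinite_of_isRegularOfDegree hG (by omega) hreg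
    exact ⟨hl, hper, isGradientGibbs_of_marginalOn hG hl.1 hmarg hq,
      (hasMarginals_iff hG hper).mpr hmarg⟩

lemma u3_pow_eq (a : ℝ) (k : ℕ) : (fun n => u3 a n ^ k) = u3 (a ^ k) := funext (u3_pow a k)

lemma u3_pow_periodic (a : ℝ) (k : ℕ) : Function.Periodic (fun n => u3 a n ^ k) (3 : ℕ) := by
  rw [u3_pow_eq]
  exact u3_periodic _

variable (hG ρ) in
lemma injOn_mixtureLaw_u3 (hk : 2 ≤ k) (hreg : G.IsRegularOfDegree (k + 1)) :
    InjOn (fun a => mixtureLaw hG ρ k β (fun n => u3 a n ^ k) 3)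
      {a | 0 < a ∧ a ≠ 1 ∧ IsBoundaryLaw k β fun n => u3 a n ^ k} := by
  intro a ⟨ha, ha1, hla⟩ b ⟨hb, _, hlb⟩ hab
  have hk0 : k ≠ 0 := by omega
  have hν := (isGGMOf_iff_eq_mixtureLaw (hG := hG) (ρ := ρ) hk0 hreg three_ne_zero hla
    (u3_pow_periodic a k)).mpr rfl
  obtain ⟨r, hr⟩ := hν.exists_starFactor_eq_mul hk0 hreg
    ((isGGMOf_iff_eq_mixtureLaw hk0 hreg three_ne_zero hlb (u3_pow_periodic b k)).mpr hab)
  simp only [u3_pow_eq] at hr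
  exact (pow_left_inj₀ ha.le hb.le hk0).mp (eq_of_starFactor_u3_eq_mul hk (pow_pos ha k).le
    (pow_pos hb k).le (pow_ne_one_of_pos ha ha1 hk0) hr)

variable (hG ρ) in
theorem encard_ggm3 (hk : 2 ≤ k) (hreg : G.IsRegularOfDegree (k + 1)) (hβ : 0 < β) :
    (ggm3 hG ρ k β).encard = ((Ioi 0 ∩ tauCurve k ⁻¹' {2 * Real.cosh β}) \ {1}).encard := by
  have himage : ggm3 hG ρ k β = (fun a => mixtureLaw hG ρ k β (fun n => u3 a n ^ k) 3) ''
      {a | 0 < a ∧ a ≠ 1 ∧ IsBoundaryLaw k β fun n => u3 a n ^ k} := by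
    ext ν
    constructor
    · rintro ⟨a, ha, ha1, hν⟩
      exact ⟨a, ⟨ha, ha1, hν.1⟩, ((isGGMOf_iff_eq_mixtureLaw (by omega) hreg three_ne_zero hν.1
        (u3_pow_periodic a k)).mp hν).symm⟩
    · rintro ⟨a, ⟨ha, ha1, hla⟩, rfl⟩
      exact ⟨a, ha, ha1, (isGGMOf_iff_eq_mixtureLaw (by omega) hreg three_ne_zero hla
        (u3_pow_periodic a k)).mpr rfl⟩
  rw [himage, (injOn_mixtureLaw_u3 hG ρ hk hreg).encard_image]
  congr 1
  ext a
  constructor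
  · rintro ⟨ha, ha1, hla⟩
    exact ⟨⟨ha, (isBoundaryLaw_u3_pow_iff hk hβ ha ha1).mp hla⟩, ha1⟩
  · rintro ⟨⟨ha, hτ⟩, ha1⟩
    exact ⟨ha, ha1, (isBoundaryLaw_u3_pow_iff hk hβ ha ha1).mpr hτ⟩

variable (hG ρ β) in
/-- The periods `3` and `4` are coprime, so the star factors of a measure in both families would be
constant in their first argument. -/
theorem disjoint_ggm3_ggm4 (hk : 2 ≤ k) (hreg : G.IsRegularOfDegree (k + 1)) :
    Disjoint (ggm3 hG ρ k β) (ggm4 hG ρ k β) := by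
  rw [Set.disjoint_left]
  rintro ν ⟨a, ha, ha1, h⟩ ⟨c, d, -, -, h'⟩
  have hk0 : k ≠ 0 := by omega
  rw [u3_pow_eq] at h
  obtain ⟨r, hr⟩ := h.exists_starFactor_eq_mul hk0 hreg h'
  have hthree : starFactor k 3 (u3 (a ^ k)) 4 0 = starFactor k 3 (u3 (a ^ k)) 1 0 :=
    periodic_starFactor k (q := 3) h.2.1 0 1
  have hfour : starFactor k 4 (fun n => u4 c d n ^ k) 4 0
      = starFactor k 4 (fun n => u4 c d n ^ k) 0 0 := by
    simpa only [Nat.cast_ofNat, zero_add] using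
      periodic_starFactor k (l := fun n => u4 c d n ^ k) (q := 4) h'.2.1 0 0
  have hconst : starFactor k 3 (u3 (a ^ k)) 0 0 = starFactor k 3 (u3 (a ^ k)) 1 0 := by
    rw [← hthree, hr, hr, hfour]
  have hdiff := starFactor_u3_sub hk0 (a ^ k)
  rw [hconst, sub_self, eq_comm, mul_eq_zero] at hdiff
  have hak := pow_ne_one_of_pos ha ha1 hk0
  exact hdiff.elim (fun h => hak (sub_eq_zero.mp h).symm)
    fun h => pow_ne_one_of_pos (pow_pos ha k) hak hk0 (sub_eq_zero.mp h).symm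

end Classification

end

end SOS

theorem mainTheorem2 (k : ℕ) (hk : 2 ≤ k) :
    ∃ τc : ℝ, 0 < τc ∧ τc < (2 * (k : ℝ) + 1) / ((k : ℝ) - 1) ∧
      ∀ (V : Type*) (G : SimpleGraph V) [G.LocallyFinite] (hG : G.IsTree)
        (_ : G.IsRegularOfDegree (k + 1)) (ρ : V) (β : ℝ) (_ : 0 < β),
        (2 * Real.cosh β < τc → SOS.ggm3 hG ρ k β = ∅) ∧
        (2 * Real.cosh β = τc → (SOS.ggm3 hG ρ k β).encard = 1) ∧
        (τc < 2 * Real.cosh β → 2 * Real.cosh β ≠ (2 * (k : ℝ) + 1) / ((k : ℝ) - 1) →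
          (SOS.ggm3 hG ρ k β).encard = 2) ∧
        (2 * Real.cosh β = (2 * (k : ℝ) + 1) / ((k : ℝ) - 1) →
          (SOS.ggm3 hG ρ k β).encard = 1) ∧
        Disjoint (SOS.ggm3 hG ρ k β) (SOS.ggm4 hG ρ k β) := by
  obtain ⟨c, hc1, hvalley⟩ := SOS.exists_isValley_tauCurve hk
  have hlt : SOS.tauCurve k c < SOS.tauCurve k 1 := hvalley.lt_of_ne one_pos hc1.ne'
  have hpos : 0 < SOS.tauCurve k c := two_pos.trans (SOS.two_lt_tauCurve hk hvalley.pos)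
  rw [← SOS.tauCurve_one hk]
  refine ⟨SOS.tauCurve k c, hpos, hlt, fun V G _ hG hreg ρ β hβ =>
    ⟨fun hτ => ?_, fun hτ => ?_, fun hτ hτ1 => ?_, fun hτ => ?_,
      SOS.disjoint_ggm3_ggm4 hG ρ β hk hreg⟩⟩
  · rw [← Set.encard_eq_zero, SOS.encard_ggm3 hG ρ hk hreg hβ, hvalley.fiber_eq_empty hτ,
      Set.empty_sdiff, Set.encard_empty]
  · rw [SOS.encard_ggm3 hG ρ hk hreg hβ, hτ, SOS.fiber_sdiff_singleton_of_ne hlt.ne,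
      hvalley.fiber_bottom, Set.encard_singleton]
  · rw [SOS.encard_ggm3 hG ρ hk hreg hβ, SOS.fiber_sdiff_singleton_of_ne hτ1,
      hvalley.encard_fiber_eq_two hτ]
  · rw [SOS.encard_ggm3 hG ρ hk hreg hβ, hτ, hvalley.encard_fiber_sdiff_self one_pos hc1.ne']
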